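/- **Setting.** All systems are finite dimensional with fixed orthonormal bases. A state is a positive semi-definite operator of trace one; a channel is a completely positive trace-preserving linear map. For channels $\mathcal N,\mathcal M$ from $C$ to $D$ let $$\|\mathcal N-\mathcal M\|_\diamond=\sup_{\rho_{RC}}\|(\mathrm{id}_R\otimes\mathcal N)(\rho_{RC})-(\mathrm{id}_R\otimes\mathcal M)(\rho_{RC})\|_1,\qquad F(\mathcal N,\mathcal M)=\inf_{\rho_{RC}}F\big((\mathrm{id}_R\otimes\mathcal N)(\rho_{RC}),(\mathrm{id}_R\otimes\mathcal M)(\rho_{RC})\big),$$ over all finite-dimensional reference systems $R$ and all states $\rho_{RC}$, where $\|X\|_1=\operatorname{Tr}\sqrt{X^\dagger X}$ and $F(\omega,\tau)=\|\sqrt\omega\sqrt\tau\|_1^2$. For a set $S$ of parties, $T_S$ is the partial transpose on all systems held by the parties in $S$ (with respect to the fixed bases). A multipartite channel $\mathcal P$, in which each party holds one input and one output system (possibly composite or trivial), is *completely PPT preserving* (C-PPT-P) if $T_{S}\circ\mathcal P\circ T_S$ is completely positive for every set $S$ of parties, where the left $T_S$ acts on the outputs and the right one on the inputs. For a multipartite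 channel $\mathcal N$ with joint input $A$ and a state $\rho$ shared by the same parties on joint system $\hat A$, define $$e_{\mathrm{PPT}}(\mathcal N,\rho)=\inf_{\mathcal P}\tfrac12\|\mathcal N-\widetilde{\mathcal N}_{\mathcal P}\|_\diamond,\qquad e^F_{\mathrm{PPT}}(\mathcal N,\rho)=\inf_{\mathcal P}\big(1-F(\mathcal N,\widetilde{\mathcal N}_{\mathcal P})\big),\qquad \widetilde{\mathcal N}_{\mathcal P}(\omega)=\mathcal P(\omega\otimes\rho),$$ where the infima are over all C-PPT-P channels $\mathcal P$ whose input at each party consists of that party's input to $\mathcal N$ and its share of $\rho$, and whose output at each party is that of $\mathcal N$. **Proposition.** Let $d\ge 2$, let $A,B$ be $d$-dimensional systems, let $\mathcal S^d_{AB}(\omega)=F_{AB}\,\omega\, F_{AB}^\dagger$ with $F_{AB}=\sum_{i,j}|i\rangle\langle j|_A\otimes|j\rangle\langle i|_B$ be the swap channel, regarded as a three-party channel in which Alice holds $A$, Bob holds $B$, and Charlie has trivial (one-dimensional) input and output, and let $\rho_{\hat A\hat B\hat C}$ be a state shared by Alice ($\hat A$), Bob ($\hat B$) and Charlie ($\hat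 C$), of arbitrary finite local dimensions. Then $$e_{\mathrm{PPT}}(\mathcal S^d_{AB},\rho_{\hat A\hat B\hat C})=e^F_{\mathrm{PPT}}(\mathcal S^d_{AB},\rho_{\hat A\hat B\hat C})=1-\sup_{K,L,M,N}\operatorname{Tr}[\rho_{\hat A\hat B\hat C}K],$$ where the supremum is over all operators $K,L,M,N\ge0$ on $\hat A\hat B\hat C$ such that $K+L+M+N=I$, $$T_{\hat C}(K),\;T_{\hat C}(L),\;T_{\hat C}(M),\;T_{\hat C}(N)\ge0,$$ and, for each $\hat S\in\{\hat A,\hat B\}$, $$T_{\hat S}\Big(K+\tfrac{L}{d+1}+\tfrac{M}{d+1}+\tfrac{N}{(d+1)^2}\Big)\ge0,$$ $$\tfrac1{d-1}T_{\hat S}\Big(L+\tfrac{N}{d+1}\Big)\ge T_{\hat S}\Big(K+\tfrac{M}{d+1}\Big),\qquad \tfrac1{d-1}T_{\hat S}\Big(M+\tfrac{N}{d+1}\Big)\ge T_{\hat S}\Big(K+\tfrac{L}{d+1}\Big),$$ $$T_{\hat S}\Big(K+\tfrac{N}{(d-1)^2}\Big)\ge\tfrac1{d-1}T_{\hat S}(L+M).$$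 -/

import Mathlib

open scoped ComplexOrder MatrixOrder

noncomputable section

namespace QChannel

/-! ### States and maps. A finite-dimensional system is a finite type, which labels its standard
basis; operators on it are square complex matrices indexed by that type. -/

/-- A quantum state (density operator): positive semi-definite with trace one. -/
def IsState {X : Type*} [Fintype X] (ρ : Matrix X X ℂ) : Prop :=
  ρ.PosSemidef ∧ ρ.trace = 1

/-- The action of `id_R ⊗ Φ` on operators on the composite system `R × C`. -/
def ampliate {C D : Type*} (R : Type*) (Φ : Matrix C C ℂ →ₗ[ℂ] Matrix D D ℂ)
    (X : Matrix (R × C) (R × C) ℂ) : Matrix (R × D) (R × D) ℂ :=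
  Matrix.of fun p q => Φ (Matrix.of fun c c' => X (p.1, c) (q.1, c')) p.2 q.2

/-- Complete positivity: `id_R ⊗ Φ` is positive for every finite-dimensional `R`. -/
def IsCP {C D : Type*} (Φ : Matrix C C ℂ →ₗ[ℂ] Matrix D D ℂ) : Prop :=
  ∀ (n : ℕ) (X : Matrix (Fin n × C) (Fin n × C) ℂ), X.PosSemidef → (ampliate (Fin n) Φ X).PosSemidef

/-- A quantum channel: a completely positive trace-preserving linear map. -/
def IsChannel {C D : Type*} [Fintype C] [Fintype D] (Φ : Matrix C C ℂ →ₗ[ℂ] Matrix D D ℂ) : Prop :=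
  IsCP Φ ∧ ∀ X, (Φ X).trace = X.trace

/-! ### Distance measures -/

/-- The trace norm `‖X‖₁ = Tr |X|`, where `|X| = √(X† X)`. -/
def traceNorm {X : Type*} [Fintype X] [DecidableEq X] (M : Matrix X X ℂ) : ℝ :=
  (CFC.abs M).trace.re

/-- The (squared, Uhlmann) fidelity `F(ω, τ) = ‖√ω √τ‖₁²`. -/
def fidelity {X : Type*} [Fintype X] [DecidableEq X] (ω τ : Matrix X X ℂ) : ℝ :=
  traceNorm (CFC.sqrt ω * CFC.sqrt τ) ^ 2

/-- The diamond distance of two channels: the supremum, over all finite-dimensional reference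
systems `R` and all states `ρ` of `R C`, of `‖(id ⊗ N)(ρ) - (id ⊗ M)(ρ)‖₁`. -/
def diamondDist {C D : Type*} [Fintype C] [Fintype D] [DecidableEq D]
    (N M : Matrix C C ℂ →ₗ[ℂ] Matrix D D ℂ) : ℝ :=
  sSup {t : ℝ | ∃ (n : ℕ) (ρ : Matrix (Fin n × C) (Fin n × C) ℂ), IsState ρ ∧
    t = traceNorm (ampliate (Fin n) N ρ - ampliate (Fin n) M ρ)}

/-- The channel fidelity: the infimum, over all finite-dimensional reference systems `R` and all
states `ρ` of `R C`, of `F((id ⊗ N)(ρ), (id ⊗ M)(ρ))`. -/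
def channelFidelity {C D : Type*} [Fintype C] [Fintype D] [DecidableEq D]
    (N M : Matrix C C ℂ →ₗ[ℂ] Matrix D D ℂ) : ℝ :=
  sInf {t : ℝ | ∃ (n : ℕ) (ρ : Matrix (Fin n × C) (Fin n × C) ℂ), IsState ρ ∧
    t = fidelity (ampliate (Fin n) N ρ) (ampliate (Fin n) M ρ)}

/-! ### Multipartite systems. Party `i` of the finite set `ι` of parties holds the system `A i`;
the standard basis of the joint system is labelled by `∀ i, A i`. -/

section Multipartite

variable {ι : Type*} [Fintype ι] [DecidableEq ι]

/-- The partial transpose `T_S` on the systems of the parties in `S`: it exchanges the `S`-parts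
of the row and the column label. -/
def partialTranspose {A : ι → Type*} (S : Finset ι) :
    Matrix (∀ i, A i) (∀ i, A i) ℂ →ₗ[ℂ] Matrix (∀ i, A i) (∀ i, A i) ℂ where
  toFun X := Matrix.of fun x y => X (S.piecewise y x) (S.piecewise x y)
  map_add' _ _ := by ext; simp
  map_smul' _ _ := by ext; simp

/-- A multipartite channel `P` is completely PPT preserving if `T_{S'} ∘ P ∘ T_S` is completely
positive for every set `S` of parties. -/
def IsCPPTP {A A' : ι → Type*} [∀ i, Fintype (A i)] [∀ i, Fintype (A' i)]
    (P : Matrix (∀ i, A i) (∀ i, A i) ℂ →ₗ[ℂ] Matrix (∀ i, A' i) (∀ i, A' i) ℂ) : Prop :=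
  IsChannel P ∧
    ∀ S : Finset ι, IsCP (partialTranspose S ∘ₗ P ∘ₗ partialTranspose S)

/-- `ω ↦ ω ⊗ ρ`, where party `i` then holds the two systems `A i` and `R i`. -/
def tensorResource {A R : ι → Type*} (ρ : Matrix (∀ i, R i) (∀ i, R i) ℂ) :
    Matrix (∀ i, A i) (∀ i, A i) ℂ →ₗ[ℂ] Matrix (∀ i, A i × R i) (∀ i, A i × R i) ℂ where
  toFun ω := Matrix.of fun x y =>
    ω (fun i => (x i).1) (fun i => (y i).1) * ρ (fun i => (x i).2) (fun i => (y i).2)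
  map_add' _ _ := by ext; simp [add_mul]
  map_smul' _ _ := by ext; simp [mul_assoc]

variable {A A' R : ι → Type*} [∀ i, Fintype (A i)] [∀ i, Fintype (A' i)] [∀ i, DecidableEq (A' i)]
  [∀ i, Fintype (R i)]

/-- The PPT simulation error of the multipartite channel `N` with resource state `ρ`, measured by
the normalized diamond distance. -/
def pptError (N : Matrix (∀ i, A i) (∀ i, A i) ℂ →ₗ[ℂ] Matrix (∀ i, A' i) (∀ i, A' i) ℂ)
    (ρ : Matrix (∀ i, R i) (∀ i, R i) ℂ) : ℝ :=
  sInf {e : ℝ | ∃ P : Matrix (∀ i, A i × R i) (∀ i, A i × R i) ℂ →ₗ[ℂ]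
      Matrix (∀ i, A' i) (∀ i, A' i) ℂ,
    IsCPPTP P ∧ e = 1 / 2 * diamondDist N (P ∘ₗ tensorResource ρ)}

/-- The PPT simulation error of the multipartite channel `N` with resource state `ρ`, measured by
the channel infidelity. -/
def pptErrorF (N : Matrix (∀ i, A i) (∀ i, A i) ℂ →ₗ[ℂ] Matrix (∀ i, A' i) (∀ i, A' i) ℂ)
    (ρ : Matrix (∀ i, R i) (∀ i, R i) ℂ) : ℝ :=
  sInf {e : ℝ | ∃ P : Matrix (∀ i, A i × R i) (∀ i, A i × R i) ℂ →ₗ[ℂ]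
      Matrix (∀ i, A' i) (∀ i, A' i) ℂ,
    IsCPPTP P ∧ e = 1 - channelFidelity N (P ∘ₗ tensorResource ρ)}

end Multipartite

/-! ### Bidirectional controlled teleportation -/

/-- The three parties. -/
inductive Party where
  | alice
  | bob
  | charlie
  deriving DecidableEq

instance : Fintype Party where
  elems := {.alice, .bob, .charlie}
  complete := by intro p; cases p <;> decide

/-- Dimensions of the systems on which the swap channel acts, for input and output alike: Alice
and Bob hold a `d`-dimensional system each, and Charlie a trivial one. -/
def swapDim (d : ℕ) : Party → ℕ
  | .alice => d
  | .bob => d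
  | .charlie => 1

/-- The system of a party on which the swap channel acts. -/
abbrev SwapSys (d : ℕ) (p : Party) : Type := Fin (swapDim d p)

/-- Exchange of the labels of Alice and Bob. -/
def flipLabel (d : ℕ) (x : ∀ p, SwapSys d p) : ∀ p, SwapSys d p
  | .alice => x .bob
  | .bob => x .alice
  | .charlie => x .charlie

/-- The swap operator `F = ∑ i j, |i⟩⟨j|_A ⊗ |j⟩⟨i|_B`. -/
def swapOp (d : ℕ) : Matrix (∀ p, SwapSys d p) (∀ p, SwapSys d p) ℂ :=
  Matrix.of fun x y => if x = flipLabel d y then 1 else 0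

/-- The unitary swap channel `ω ↦ F ω F†`. -/
def swapChannel (d : ℕ) : Matrix (∀ p, SwapSys d p) (∀ p, SwapSys d p) ℂ →ₗ[ℂ]
    Matrix (∀ p, SwapSys d p) (∀ p, SwapSys d p) ℂ where
  toFun ω := swapOp d * ω * (swapOp d).conjTranspose
  map_add' _ _ := by simp [Matrix.mul_add, Matrix.add_mul]
  map_smul' _ _ := by simp

/-- The constraints of the semi-definite program on the operators `K, L, M, N` on the resource
systems. Inequalities are in the Loewner order. -/
structure SwapFeasible (d : ℕ) {R : Party → Type*} [∀ p, Fintype (R p)] [∀ p, DecidableEq (R p)]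
    (K L M N : Matrix (∀ p, R p) (∀ p, R p) ℂ) : Prop where
  nonneg_K : 0 ≤ K
  nonneg_L : 0 ≤ L
  nonneg_M : 0 ≤ M
  nonneg_N : 0 ≤ N
  sum_eq_one : K + L + M + N = 1
  ppt_one : ∀ p ∈ ({.alice, .bob} : Set Party), 0 ≤ partialTranspose {p}
    (K + (1 / ((d : ℝ) + 1)) • L + (1 / ((d : ℝ) + 1)) • M + (1 / ((d : ℝ) + 1) ^ 2) • N)
  ppt_two : ∀ p ∈ ({.alice, .bob} : Set Party),
    partialTranspose {p} (K + (1 / ((d : ℝ) + 1)) • M) ≤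
      (1 / ((d : ℝ) - 1)) • partialTranspose {p} (L + (1 / ((d : ℝ) + 1)) • N)
  ppt_three : ∀ p ∈ ({.alice, .bob} : Set Party),
    partialTranspose {p} (K + (1 / ((d : ℝ) + 1)) • L) ≤
      (1 / ((d : ℝ) - 1)) • partialTranspose {p} (M + (1 / ((d : ℝ) + 1)) • N)
  ppt_four : ∀ p ∈ ({.alice, .bob} : Set Party),
    (1 / ((d : ℝ) - 1)) • partialTranspose {p} (L + M) ≤
      partialTranspose {p} (K + (1 / ((d : ℝ) - 1) ^ 2) • N)
  ppt_charlie_K : 0 ≤ partialTranspose {Party.charlie} K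
  ppt_charlie_L : 0 ≤ partialTranspose {Party.charlie} L
  ppt_charlie_M : 0 ≤ partialTranspose {Party.charlie} M
  ppt_charlie_N : 0 ≤ partialTranspose {Party.charlie} N

end QChannel

end

open QChannel

/-! Group the labels of a Choi matrix as Alice's input with Bob's output and Bob's input with
Alice's output. The Choi matrix of the swap is then Φ ⊗ Φ, where Φ = `maxEnt d` and Φ/d is a
projector. A partial transpose for Alice or for Bob turns Φ into the flip F in both factors, and the
operators 1 ± F are positive. The constraints of the program express positivity in terms of the four
products (1 ± F) ⊗ (1 ± F).

Achievability: measure the resource with K, L, M, N and, up to the swap, apply to each of the two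
systems either the identity or the channel with Choi matrix (d·1 - Φ)/(d² - 1). The partially
transposed Choi matrix is a combination of the products (1 ± F) ⊗ (1 ± F) whose coefficients are
exactly the operators that the program requires to be positive, so the simulation is admissible
(`SwapFeasible.isCPPTP`). With resource ρ it equals Tr[ρK] times the swap plus a completely positive
remainder (`SwapFeasible.simulation_eq`), which bounds both errors by 1 - Tr[ρK].

Converse: pair the Choi matrix of an arbitrary admissible P with normalized products of Φ/d and 1 -
Φ/d (`twirlPart`). This reads off the components that twirling would leave, with no averaging over a
group. Pairing with a positive operator gives a positive operator and is compatible with partial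
transposes (`partialTranspose_resourcePairing`), so pairing with (1 ± Φ) ⊗ (1 ± Φ) yields the
constraints (`twirlPart_feasible`). On a maximally entangled input the swap has a pure output, whose
overlap with the simulated output is Tr[ρK] (`trace_mul_twirlPart`). This bounds both errors from
below by 1 - Tr[ρK]. -/

namespace QChannel

open Matrix

/-! ### Trace norm and fidelity of operators. -/

section TraceNorm

variable {X : Type*} [Fintype X] [DecidableEq X]

open scoped Matrix.Norms.L2Operator in
theorem sqrt_mono {A B : Matrix X X ℂ} (h : A ≤ B) : CFC.sqrt A ≤ CFC.sqrt B :=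
  CFC.sqrt_le_sqrt A B h

theorem trace_mul_nonneg {A B : Matrix X X ℂ} (hA : 0 ≤ A) (hB : 0 ≤ B) :
    0 ≤ (A * B).trace := by
  have h := CFC.sqrt_mul_sqrt_self A hA
  have hs : (CFC.sqrt A).IsHermitian :=
    (nonneg_iff_posSemidef.1 (CFC.sqrt_nonneg A)).isHermitian
  have h2 := ((nonneg_iff_posSemidef.1 hB).mul_mul_conjTranspose_same (CFC.sqrt A)).trace_nonneg
  rw [hs.eq, Matrix.trace_mul_comm, ← Matrix.mul_assoc, h] at h2
  exact h2

theorem trace_mul_le_trace_mul {A B C : Matrix X X ℂ} (hA : 0 ≤ A) (h : B ≤ C) :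
    (A * B).trace ≤ (A * C).trace := by
  have := trace_mul_nonneg hA (sub_nonneg.2 h)
  rwa [Matrix.mul_sub, trace_sub, sub_nonneg] at this

/-- In an eigenbasis of |A|, the relation A†A = |A|² says that the columns of A have the eigenvalues
of |A| as norms, and a diagonal entry is bounded by the norm of its column. -/
theorem re_trace_le_traceNorm (A : Matrix X X ℂ) : A.trace.re ≤ traceNorm A := by
  have hH := nonneg_iff_posSemidef.1 (CFC.abs_nonneg A)
  have hsq : CFC.abs A * CFC.abs A = Aᴴ * A := CFC.abs_mul_abs A
  unfold traceNorm
  generalize CFC.abs A = H at *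
  set U : Matrix X X ℂ := (hH.1.eigenvectorUnitary : Matrix X X ℂ) with hU
  have hUU : U * star U = 1 := Unitary.coe_mul_star_self _
  have hUU' : star U * U = 1 := Unitary.coe_star_mul_self _
  have hspec := hH.1.spectral_theorem
  rw [Unitary.conjStarAlgAut_apply] at hspec
  set Dg : Matrix X X ℂ := diagonal (RCLike.ofReal ∘ hH.1.eigenvalues)
  change H = U * Dg * star U at hspec
  have htr : A.trace = (star U * A * U).trace := by
    rw [Matrix.mul_assoc, Matrix.trace_mul_comm, Matrix.mul_assoc, hUU, Matrix.mul_one]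
  have hY : (star U * A * U)ᴴ * (star U * A * U) = Dg * Dg := by
    have e : (star U * A * U)ᴴ = star U * Aᴴ * U := by
      simp [conjTranspose_mul, star_eq_conjTranspose, Matrix.mul_assoc]
    calc _ = star U * (Aᴴ * (U * star U) * A) * U := by rw [e]; noncomm_ring
      _ = star U * (H * H) * U := by rw [hUU, Matrix.mul_one, hsq]
      _ = (star U * U) * Dg * (star U * U) * Dg * (star U * U) := by
        rw [hspec]; noncomm_ring
      _ = Dg * Dg := by rw [hUU']; simp
  rw [htr, hH.1.trace_eq_sum_eigenvalues]
  simp only [trace, diag_apply, Complex.re_sum]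
  refine Finset.sum_le_sum fun i _ => ?_
  have h1 := congrFun (congrFun hY i) i
  rw [diagonal_mul_diagonal, diagonal_apply_eq, Matrix.mul_apply] at h1
  have h2 := congrArg Complex.re h1
  simp only [Complex.re_sum, conjTranspose_apply, Function.comp] at h2
  have h3 : ((star U * A * U) i i).re ^ 2 ≤ hH.1.eigenvalues i ^ 2 := by
    have h4 : ∀ j, (star ((star U * A * U) j i) * (star U * A * U) j i).re
        = Complex.normSq ((star U * A * U) j i) := by
      intro j; simp [Complex.normSq_apply]
    simp only [h4] at h2
    have h5 := Finset.single_le_sum (f := fun j => Complex.normSq ((star U * A * U) j i))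
      (fun j _ => Complex.normSq_nonneg _) (Finset.mem_univ i)
    have h6 : ((RCLike.ofReal (hH.1.eigenvalues i) : ℂ) * RCLike.ofReal (hH.1.eigenvalues i)).re
        = hH.1.eigenvalues i ^ 2 := by
      simp [sq]
    rw [h6] at h2
    rw [Complex.normSq_apply] at h5
    nlinarith [mul_self_nonneg ((star U * A * U) i i).im]
  simpa using abs_le_of_sq_le_sq' h3 (hH.eigenvalues_nonneg i) |>.2

/-- Write |A - B| = (A - B) sgn(A - B), where the sign lies between -1 and 1. -/
theorem traceNorm_sub_le {A B : Matrix X X ℂ} (hA : A.PosSemidef) (hB : B.PosSemidef) :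
    traceNorm (A - B) ≤ A.trace.re + B.trace.re := by
  have hsa : IsSelfAdjoint (A - B) := hA.1.sub hB.1
  have hc : ∀ f : ℝ → ℝ, ContinuousOn f (spectrum ℝ (A - B)) := fun f =>
    (Matrix.finite_real_spectrum).continuousOn f
  have habs : CFC.abs (A - B) = (A - B) * cfc Real.sign (A - B) := by
    rw [CFC.abs_eq_cfc_norm (A - B) hsa]
    nth_rw 2 [← cfc_id ℝ (A - B) hsa]
    rw [← cfc_mul _ _ _ (hc _) (hc _)]
    congr 1
    ext x
    rcases lt_trichotomy x 0 with h | h | h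
    · simp [Real.sign_of_neg h, abs_of_neg h]
    · simp [h]
    · simp [Real.sign_of_pos h, abs_of_pos h]
  have h1 : cfc Real.sign (A - B) ≤ 1 := cfc_le_one _ _ fun x _ => by
    rcases Real.sign_apply_eq x with h | h | h <;> rw [h] <;> norm_num
  have h2 : -1 ≤ cfc Real.sign (A - B) := by
    have : (algebraMap ℝ (Matrix X X ℂ)) (-1) ≤ cfc Real.sign (A - B) :=
      algebraMap_le_cfc _ _ _ (fun x _ => by
        rcases Real.sign_apply_eq x with h | h | h <;> rw [h] <;> norm_num) (hc _) hsa
    simpa using this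
  have h3 := (Complex.le_def.1 (trace_mul_le_trace_mul (nonneg_iff_posSemidef.2 hA) h1)).1
  have h4 := (Complex.le_def.1 (trace_mul_le_trace_mul (nonneg_iff_posSemidef.2 hB) h2)).1
  unfold traceNorm
  rw [habs, Matrix.sub_mul, trace_sub, Complex.sub_re]
  simp only [Matrix.mul_one, Matrix.mul_neg, trace_neg, Complex.neg_re] at h3 h4
  linarith

omit [DecidableEq X] in
theorem dotProduct_mulVec_eq_trace (ψ : X → ℂ) (A : Matrix X X ℂ) :
    star ψ ⬝ᵥ A *ᵥ ψ = (A * vecMulVec ψ (star ψ)).trace := by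
  rw [mul_vecMulVec, trace_vecMulVec, dotProduct_comm]

omit [DecidableEq X] in
theorem vecMulVec_isIdempotent {ψ : X → ℂ} (hψ : star ψ ⬝ᵥ ψ = 1) :
    vecMulVec ψ (star ψ) * vecMulVec ψ (star ψ) = vecMulVec ψ (star ψ) := by
  rw [vecMulVec_mul_vecMulVec, hψ, one_smul]

theorem vecMulVec_le_one {ψ : X → ℂ} (hψ : star ψ ⬝ᵥ ψ = 1) : vecMulVec ψ (star ψ) ≤ 1 := by
  rw [le_iff]
  have h : (1 - vecMulVec ψ (star ψ)) = (1 - vecMulVec ψ (star ψ)) * (1 - vecMulVec ψ (star ψ))ᴴ := by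
    have h1 := (posSemidef_vecMulVec_self_star ψ).1.eq
    simp [h1, Matrix.mul_sub, Matrix.sub_mul, vecMulVec_isIdempotent hψ]
  rw [h]
  exact posSemidef_self_mul_conjTranspose _

/-- For traceless A, |A| + A = 2A⁺ gives ‖A‖₁ = 2 Tr A⁺. Then use A ≤ A⁺ and |ψ⟩⟨ψ| ≤ 1. -/
theorem two_mul_le_traceNorm {A : Matrix X X ℂ} (hA : A.IsHermitian) (htr : A.trace = 0)
    {ψ : X → ℂ} (hψ : star ψ ⬝ᵥ ψ = 1) : 2 * (star ψ ⬝ᵥ A *ᵥ ψ).re ≤ traceNorm A := by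
  have hsa : IsSelfAdjoint A := hA
  have h1 := congrArg (fun M => (trace M).re) (CFC.abs_add_self A hsa)
  simp only [trace_add, htr, add_zero, trace_smul] at h1
  have h2 := (Complex.le_def.1 (trace_mul_le_trace_mul (CFC.posPart_nonneg A)
    (vecMulVec_le_one hψ))).1
  have h3 := (Complex.le_def.1 (trace_mul_nonneg (CFC.negPart_nonneg A)
    (nonneg_iff_posSemidef.2 (posSemidef_vecMulVec_self_star ψ)))).1
  have h4 := CFC.posPart_sub_negPart A hsa
  rw [traceNorm, h1, dotProduct_mulVec_eq_trace]
  nth_rw 1 [← h4]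
  rw [Matrix.sub_mul, trace_sub]
  rw [Matrix.mul_one] at h2
  simp at h3 ⊢
  linarith

/-- With φ = √σ ψ, the operator |ψ⟩⟨ψ|√σ = |ψ⟩⟨φ| has absolute value |φ⟩⟨φ|/‖φ‖ and hence trace norm
‖φ‖. -/
theorem fidelity_pure {ψ : X → ℂ} (hψ : star ψ ⬝ᵥ ψ = 1) {σ : Matrix X X ℂ} (hσ : σ.PosSemidef) :
    fidelity (vecMulVec ψ (star ψ)) σ = (star ψ ⬝ᵥ σ *ᵥ ψ).re := by
  have hP := posSemidef_vecMulVec_self_star ψ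
  have hs : CFC.sqrt (vecMulVec ψ (star ψ)) = vecMulVec ψ (star ψ) :=
    CFC.sqrt_unique (vecMulVec_isIdempotent hψ) (nonneg_iff_posSemidef.2 hP)
  have hH : (CFC.sqrt σ).IsHermitian :=
    (nonneg_iff_posSemidef.1 (CFC.sqrt_nonneg σ)).isHermitian
  set φ : X → ℂ := CFC.sqrt σ *ᵥ ψ with hφ
  have hφs : star φ = star ψ ᵥ* CFC.sqrt σ := by rw [hφ, star_mulVec, hH.eq]
  have hn : star φ ⬝ᵥ φ = star ψ ⬝ᵥ σ *ᵥ ψ := by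
    rw [hφs, hφ, ← dotProduct_mulVec, mulVec_mulVec,
      CFC.sqrt_mul_sqrt_self σ (nonneg_iff_posSemidef.2 hσ)]
  have hnn : 0 ≤ star φ ⬝ᵥ φ := dotProduct_star_self_nonneg φ
  obtain ⟨r, hr0, hr⟩ : ∃ r : ℝ, 0 ≤ r ∧ star φ ⬝ᵥ φ = ((r ^ 2 : ℝ) : ℂ) := by
    refine ⟨Real.sqrt (star φ ⬝ᵥ φ).re, Real.sqrt_nonneg _, ?_⟩
    rw [Real.sq_sqrt (Complex.le_def.1 hnn).1]
    exact (Complex.ext rfl (Complex.le_def.1 hnn).2.symm)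
  have habs : CFC.abs (vecMulVec ψ (star ψ) * CFC.sqrt σ)
      = ((r⁻¹ : ℝ) : ℂ) • vecMulVec φ (star φ) := by
    refine CFC.sqrt_unique ?_ ?_
    · have e1 : star (vecMulVec ψ (star ψ) * CFC.sqrt σ) * (vecMulVec ψ (star ψ) * CFC.sqrt σ)
          = vecMulVec φ (star φ) := by
        rw [star_eq_conjTranspose, conjTranspose_mul, hH.eq, hP.1.eq, Matrix.mul_assoc,
          ← Matrix.mul_assoc _ _ (CFC.sqrt σ), vecMulVec_isIdempotent hψ, vecMulVec_mul,
          mul_vecMulVec, hφs]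
      rw [e1, smul_mul_smul_comm, vecMulVec_mul_vecMulVec, hr, vecMulVec_smul, smul_smul]
      -- If r = 0 then φ = 0, and the convention 0⁻¹ = 0 keeps the formula true.
      rcases eq_or_ne r 0 with h0 | h0
      · have : φ = 0 := by
          rw [h0] at hr
          exact dotProduct_star_self_eq_zero.1 (by simpa using hr)
        simp [this]
      · have : ((r⁻¹ : ℝ) : ℂ) * ((r⁻¹ : ℝ) : ℂ) * ((r ^ 2 : ℝ) : ℂ) = 1 := by
          rw [← Complex.ofReal_mul, ← Complex.ofReal_mul]
          rw [show r⁻¹ * r⁻¹ * r ^ 2 = 1 by field_simp]; simp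
        rw [this, one_smul]
    · exact nonneg_iff_posSemidef.2 ((posSemidef_vecMulVec_self_star φ).smul
        (by exact_mod_cast inv_nonneg.2 hr0))
  rw [fidelity, hs, traceNorm, habs, trace_smul, trace_vecMulVec, dotProduct_comm, ← hn, hr,
    smul_eq_mul, ← Complex.ofReal_mul, Complex.ofReal_re, Complex.ofReal_re]
  rcases eq_or_ne r 0 with h0 | h0
  · simp [h0]
  · field_simp

/-- The square root is operator monotone, so √k √ω ≤ √τ. Multiplying by √ω and taking the trace
gives √k ≤ Re Tr √ω√τ. -/
theorem le_fidelity {ω τ : Matrix X X ℂ} (hω : ω.PosSemidef) (htr : ω.trace = 1) {k : ℝ}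
    (hk : 0 ≤ k) (h : (k : ℂ) • ω ≤ τ) : k ≤ fidelity ω τ := by
  have hω0 := nonneg_iff_posSemidef.2 hω
  have hs : CFC.sqrt ((k : ℂ) • ω) = ((Real.sqrt k : ℝ) : ℂ) • CFC.sqrt ω := by
    refine CFC.sqrt_unique ?_ ?_
    · rw [smul_mul_smul_comm, CFC.sqrt_mul_sqrt_self ω hω0, ← Complex.ofReal_mul,
        Real.mul_self_sqrt hk]
    · exact nonneg_iff_posSemidef.2 ((nonneg_iff_posSemidef.1 (CFC.sqrt_nonneg ω)).smul
        (by exact_mod_cast Real.sqrt_nonneg k))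
  have h1 := sqrt_mono h
  rw [hs] at h1
  have h2 := (Complex.le_def.1 (trace_mul_le_trace_mul (CFC.sqrt_nonneg ω) h1)).1
  rw [Matrix.mul_smul, CFC.sqrt_mul_sqrt_self ω hω0, trace_smul, htr] at h2
  have h3 := h2.trans (re_trace_le_traceNorm (CFC.sqrt ω * CFC.sqrt τ))
  simp at h3
  calc k = Real.sqrt k ^ 2 := (Real.sq_sqrt hk).symm
    _ ≤ _ := pow_le_pow_left₀ (Real.sqrt_nonneg k) h3 2

end TraceNorm

theorem sum_sum_comm {α β : Type*} [Fintype α] [Fintype β] (f : α → α → β → β → ℂ) :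
    ∑ a, ∑ a', ∑ b, ∑ b', f a a' b b' = ∑ b, ∑ b', ∑ a, ∑ a', f a a' b b' := by
  rw [Finset.sum_congr rfl fun a _ => Finset.sum_comm, Finset.sum_comm]
  refine Finset.sum_congr rfl fun b _ => ?_
  rw [Finset.sum_congr rfl fun a _ => Finset.sum_comm, Finset.sum_comm]

section Choi

variable {C D : Type*}

theorem ampliate_add (R : Type*) (Φ Ψ : Matrix C C ℂ →ₗ[ℂ] Matrix D D ℂ)
    (X : Matrix (R × C) (R × C) ℂ) :
    ampliate R (Φ + Ψ) X = ampliate R Φ X + ampliate R Ψ X := by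
  ext; simp [ampliate]

theorem ampliate_smul (R : Type*) (k : ℂ) (Φ : Matrix C C ℂ →ₗ[ℂ] Matrix D D ℂ)
    (X : Matrix (R × C) (R × C) ℂ) : ampliate R (k • Φ) X = k • ampliate R Φ X := by
  ext; simp [ampliate]

theorem trace_ampliate {R : Type*} [Fintype R] [Fintype C] [Fintype D]
    {Φ : Matrix C C ℂ →ₗ[ℂ] Matrix D D ℂ} (hΦ : ∀ X, (Φ X).trace = X.trace)
    (X : Matrix (R × C) (R × C) ℂ) : (ampliate R Φ X).trace = X.trace := by
  simp only [trace, Fintype.sum_prod_type]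
  refine Finset.sum_congr rfl fun r _ => ?_
  exact hΦ (Matrix.of fun c c' => X (r, c) (r, c'))

theorem IsChannel.isState_ampliate [Fintype C] [Fintype D]
    {Φ : Matrix C C ℂ →ₗ[ℂ] Matrix D D ℂ} (hΦ : IsChannel Φ) {n : ℕ}
    {ρ : Matrix (Fin n × C) (Fin n × C) ℂ} (hρ : IsState ρ) : IsState (ampliate (Fin n) Φ ρ) :=
  ⟨hΦ.1 n ρ hρ.1, (trace_ampliate hΦ.2 ρ).trans hρ.2⟩

/-! ### Bounds on diamond distance and channel fidelity. -/

section Distance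

variable [Fintype C] [Fintype D] [DecidableEq D] {N M T : Matrix C C ℂ →ₗ[ℂ] Matrix D D ℂ}

/-- The outputs differ by (1 - k) N(ρ) - T(ρ), a difference of positive operators that both have
trace 1 - k. -/
theorem diamondDist_le_of_eq_add (hN : IsChannel N) (hM : IsChannel M) (hT : IsCP T) {k : ℝ}
    (hk : k ≤ 1) (h : M = (k : ℂ) • N + T) : diamondDist N M ≤ 2 * (1 - k) := by
  -- An empty set of values would have supremum 0, whence the side goal `0 ≤ 2 * (1 - k)`.
  refine Real.sSup_le ?_ (by linarith)
  rintro t ⟨n, ρ, hρ, rfl⟩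
  have hNρ := hN.isState_ampliate hρ
  have hMρ := hM.isState_ampliate hρ
  have e : ampliate (Fin n) M ρ = (k : ℂ) • ampliate (Fin n) N ρ + ampliate (Fin n) T ρ := by
    rw [h, ampliate_add, ampliate_smul]
  have htr := congrArg trace e
  rw [hMρ.2, trace_add, trace_smul, hNρ.2] at htr
  have e2 : ampliate (Fin n) N ρ - ampliate (Fin n) M ρ
      = ((1 - k : ℝ) : ℂ) • ampliate (Fin n) N ρ - ampliate (Fin n) T ρ := by
    rw [e]; push_cast; rw [sub_smul, one_smul]; abel
  rw [e2]
  refine (traceNorm_sub_le (hNρ.1.smul ?_) (hT n ρ hρ.1)).trans ?_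
  · exact_mod_cast sub_nonneg.2 hk
  · have h1 := congrArg Complex.re htr
    rw [trace_smul, hNρ.2]
    simp at h1 ⊢
    linarith

theorem le_channelFidelity_of_eq_add (hN : IsChannel N) (hT : IsCP T) {k : ℝ}
    (hk : 0 ≤ k) (h : M = (k : ℂ) • N + T)
    (hne : ∃ (n : ℕ) (ρ : Matrix (Fin n × C) (Fin n × C) ℂ), IsState ρ) :
    k ≤ channelFidelity N M := by
  obtain ⟨n, ρ, hρ⟩ := hne
  -- A real infimum over the empty set is 0, so some input state must exist.
  refine le_csInf ⟨_, n, ρ, hρ, rfl⟩ ?_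
  rintro t ⟨n, ρ, hρ, rfl⟩
  have hNρ := hN.isState_ampliate hρ
  refine le_fidelity hNρ.1 hNρ.2 hk ?_
  rw [h, ampliate_add, ampliate_smul, le_iff, add_sub_cancel_left]
  exact hT n ρ hρ.1

/-- A pure target output ψ turns `two_mul_le_traceNorm` into a lower bound by the overlap with ψ. -/
theorem one_sub_le_half_diamondDist (hN : IsChannel N) (hM : IsChannel M) {n : ℕ}
    {ρ : Matrix (Fin n × C) (Fin n × C) ℂ} (hρ : IsState ρ) {ψ : Fin n × D → ℂ}
    (hψ : star ψ ⬝ᵥ ψ = 1) (h : ampliate (Fin n) N ρ = vecMulVec ψ (star ψ)) :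
    1 - (star ψ ⬝ᵥ ampliate (Fin n) M ρ *ᵥ ψ).re ≤ 1 / 2 * diamondDist N M := by
  have hbdd : BddAbove {t : ℝ | ∃ (n : ℕ) (ρ : Matrix (Fin n × C) (Fin n × C) ℂ), IsState ρ ∧
      t = traceNorm (ampliate (Fin n) N ρ - ampliate (Fin n) M ρ)} := by
    refine ⟨2, ?_⟩
    rintro t ⟨n, ρ, hρ, rfl⟩
    have h1 := hN.isState_ampliate hρ
    have h2 := hM.isState_ampliate hρ
    have := traceNorm_sub_le h1.1 h2.1
    rw [h1.2, h2.2] at this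
    norm_num at this
    exact this
  have h1 := le_csSup hbdd ⟨n, ρ, hρ, rfl⟩
  change _ ≤ diamondDist N M at h1
  have hNρ := hN.isState_ampliate hρ
  have hMρ := hM.isState_ampliate hρ
  have h2 := two_mul_le_traceNorm (hNρ.1.1.sub hMρ.1.1)
    (by rw [trace_sub, hNρ.2, hMρ.2, sub_self]) hψ
  have h3 : star ψ ⬝ᵥ ampliate (Fin n) N ρ *ᵥ ψ = 1 := by
    rw [h, dotProduct_mulVec_eq_trace, vecMulVec_isIdempotent hψ, trace_vecMulVec,
      dotProduct_comm, hψ]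
  rw [sub_mulVec, dotProduct_sub, h3, Complex.sub_re, Complex.one_re] at h2
  linarith

theorem channelFidelity_le (hM : IsChannel M) {n : ℕ}
    {ρ : Matrix (Fin n × C) (Fin n × C) ℂ} (hρ : IsState ρ) {ψ : Fin n × D → ℂ}
    (hψ : star ψ ⬝ᵥ ψ = 1) (h : ampliate (Fin n) N ρ = vecMulVec ψ (star ψ)) :
    channelFidelity N M ≤ (star ψ ⬝ᵥ ampliate (Fin n) M ρ *ᵥ ψ).re := by
  rw [← fidelity_pure hψ (hM.isState_ampliate hρ).1, ← h]
  refine csInf_le ⟨0, ?_⟩ ⟨n, ρ, hρ, rfl⟩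
  rintro t ⟨n, ρ, -, rfl⟩
  exact sq_nonneg _

end Distance

/-! ### Choi matrices and complete positivity. -/

/-- The sum is V H V†, where V sums out the label z. Combined with the Schur product theorem, this
gives both `isCP_ofChoi` and `posSemidef_resourcePairing`. -/
theorem posSemidef_sum_sum {Y Z : Type*} [Fintype Y] [Fintype Z]
    {H : Matrix (Y × Z) (Y × Z) ℂ} (hH : H.PosSemidef) :
    (Matrix.of fun y y' => ∑ z, ∑ z', H (y, z) (y', z')).PosSemidef := by
  classical
  let V : Matrix Y (Y × Z) ℂ := Matrix.of fun y p => if p.1 = y then 1 else 0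
  have e : (Matrix.of fun y y' => ∑ z, ∑ z', H (y, z) (y', z')) = V * H * Vᴴ := by
    ext y y'
    simp only [V, Matrix.mul_apply, Fintype.sum_prod_type_right, of_apply, conjTranspose_apply,
      apply_ite star, star_one, star_zero, ite_mul, one_mul, zero_mul, mul_ite, mul_one, mul_zero,
      Finset.sum_ite_eq', Finset.mem_univ, if_true]
    exact Finset.sum_comm
  rw [e]
  exact hH.mul_mul_conjTranspose_same V

/-- The Choi matrix of a map. -/
def choi [DecidableEq C] (Φ : Matrix C C ℂ →ₗ[ℂ] Matrix D D ℂ) : Matrix (C × D) (C × D) ℂ :=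
  Matrix.of fun p q => Φ (single p.1 q.1 1) p.2 q.2

/-- The map with a given Choi matrix. -/
def ofChoi [Fintype C] :
    Matrix (C × D) (C × D) ℂ →ₗ[ℂ] Matrix C C ℂ →ₗ[ℂ] Matrix D D ℂ :=
  LinearMap.mk₂ ℂ (fun J X => Matrix.of fun d d' => ∑ c, ∑ c', X c c' * J (c, d) (c', d'))
    (fun _ _ _ => by ext; simp [mul_add, Finset.sum_add_distrib])
    (fun _ _ _ => by ext; simp [Finset.mul_sum, mul_left_comm])
    (fun _ _ _ => by ext; simp [add_mul, Finset.sum_add_distrib])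
    (fun _ _ _ => by ext; simp [Finset.mul_sum, mul_assoc])

theorem ofChoi_apply [Fintype C] (J : Matrix (C × D) (C × D) ℂ) (X : Matrix C C ℂ) (d d' : D) :
    ofChoi J X d d' = ∑ c, ∑ c', X c c' * J (c, d) (c', d') := rfl

theorem ofChoi_choi [Fintype C] [DecidableEq C] (Φ : Matrix C C ℂ →ₗ[ℂ] Matrix D D ℂ) :
    ofChoi (choi Φ) = Φ := by
  refine LinearMap.ext fun X => ?_
  ext d d'
  conv_rhs => rw [matrix_eq_sum_single X]
  simp only [map_sum, Matrix.sum_apply, ofChoi_apply, choi, of_apply]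
  refine Finset.sum_congr rfl fun c _ => Finset.sum_congr rfl fun c' _ => ?_
  have h : single c c' (X c c') = X c c' • single c c' (1 : ℂ) := by simp
  rw [h, map_smul, Matrix.smul_apply, smul_eq_mul]

theorem isCP_ofChoi [Fintype C] [Fintype D] {J : Matrix (C × D) (C × D) ℂ} (hJ : J.PosSemidef) :
    IsCP (ofChoi J) := by
  intro n X hX
  have h := posSemidef_sum_sum (Y := Fin n × D) (Z := C)
    ((hX.submatrix (fun p : (Fin n × D) × C => (p.1.1, p.2))).hadamard
      (hJ.submatrix (fun p : (Fin n × D) × C => (p.2, p.1.2))))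
  exact h

/-- The unnormalized maximally entangled vector of a system and its copy. -/
noncomputable def entangledVec (C : Type*) [Fintype C] [DecidableEq C] : Fin (Fintype.card C) × C → ℂ :=
  fun p => if Fintype.equivFin C p.2 = p.1 then 1 else 0

theorem ampliate_entangledVec [Fintype C] [DecidableEq C]
    (Φ : Matrix C C ℂ →ₗ[ℂ] Matrix D D ℂ) :
    ampliate _ Φ (vecMulVec (entangledVec C) (star (entangledVec C))) =
      (choi Φ).submatrix ((Fintype.equivFin C).symm.prodCongr (Equiv.refl D))
        ((Fintype.equivFin C).symm.prodCongr (Equiv.refl D)) := by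
  ext ⟨i, d⟩ ⟨i', d'⟩
  simp only [choi, ampliate, of_apply, submatrix_apply]
  refine congrArg (fun Y => Φ Y d d') ?_
  ext a a'
  have h : ∀ i a, Fintype.equivFin C a = i ↔ (Fintype.equivFin C).symm i = a := fun i a => by
    rw [Equiv.symm_apply_eq, eq_comm]
  simp only [single, of_apply, entangledVec, vecMulVec_apply, Pi.star_apply, h]
  by_cases h1 : (Fintype.equivFin C).symm i = a <;>
    by_cases h2 : (Fintype.equivFin C).symm i' = a' <;> simp [h1, h2]

theorem IsCP.posSemidef_choi [Fintype C] [DecidableEq C] {Φ : Matrix C C ℂ →ₗ[ℂ] Matrix D D ℂ}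
    (hΦ : IsCP Φ) : (choi Φ).PosSemidef := by
  have h := (hΦ _ _ (posSemidef_vecMulVec_self_star (entangledVec C))).submatrix
    ((Fintype.equivFin C).prodCongr (Equiv.refl D))
  rw [ampliate_entangledVec] at h
  convert h using 1
  ext ⟨c, d⟩ ⟨c', d'⟩
  simp

theorem trace_ofChoi [Fintype C] [DecidableEq C] [Fintype D] {J : Matrix (C × D) (C × D) ℂ}
    (hJ : ∀ c c', ∑ d, J (c, d) (c', d) = if c = c' then 1 else 0) (X : Matrix C C ℂ) :
    (ofChoi J X).trace = X.trace := by
  simp only [trace, diag_apply, ofChoi_apply]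
  rw [Finset.sum_comm]
  refine Finset.sum_congr rfl fun c _ => ?_
  rw [Finset.sum_comm]
  simp [← Finset.mul_sum, hJ]

end Choi

/-! ### Partial transposes of Choi matrices and pairing with the resource. -/

section Multipartite

variable {ι : Type*} [Fintype ι] [DecidableEq ι] {A A' R : ι → Type*}

omit [Fintype ι] in
theorem piecewise_prodMk {A R : ι → Type*} (S : Finset ι) (a a' : ∀ i, A i) (r r' : ∀ i, R i) :
    (S.piecewise (fun i => (a i, r i)) (fun i => (a' i, r' i)) : ∀ i, A i × R i)
      = fun i => (S.piecewise a a' i, S.piecewise r r' i) := by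
  funext i
  by_cases h : i ∈ S <;> simp [h]

omit [Fintype ι] in
theorem fst_piecewise (S : Finset ι) (x y : ∀ i, A i × R i) :
    (fun i => (S.piecewise x y i).1) = S.piecewise (fun i => (x i).1) (fun i => (y i).1) := by
  funext i
  by_cases h : i ∈ S <;> simp [h]

omit [Fintype ι] in
theorem snd_piecewise (S : Finset ι) (x y : ∀ i, A i × R i) :
    (fun i => (S.piecewise x y i).2) = S.piecewise (fun i => (x i).2) (fun i => (y i).2) := by
  funext i
  by_cases h : i ∈ S <;> simp [h]

omit [Fintype ι] in
theorem piecewise_piecewise_swap (S : Finset ι) (x y : ∀ i, A i) :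
    S.piecewise (S.piecewise x y) (S.piecewise y x) = x := by
  funext i
  by_cases h : i ∈ S <;> simp [h]

omit [Fintype ι] in
theorem partialTranspose_apply (S : Finset ι) (X : Matrix (∀ i, A i) (∀ i, A i) ℂ) (x y) :
    partialTranspose S X x y = X (S.piecewise y x) (S.piecewise x y) := rfl

theorem partialTranspose_single [∀ i, DecidableEq (A i)] (S : Finset ι) (x y : ∀ i, A i) (c : ℂ) :
    partialTranspose S (single x y c) = single (S.piecewise y x) (S.piecewise x y) c := by
  ext u v
  simp only [partialTranspose_apply, single, of_apply]
  congr 1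
  refine propext ⟨?_, ?_⟩
  · rintro ⟨h1, h2⟩
    rw [h1, h2]
    exact ⟨piecewise_piecewise_swap S u v, piecewise_piecewise_swap S v u⟩
  · rintro ⟨h1, h2⟩
    rw [← h1, ← h2]
    exact ⟨(piecewise_piecewise_swap S x y).symm, (piecewise_piecewise_swap S y x).symm⟩

/-- The partial transpose of a Choi matrix on the inputs and outputs of the parties in `S`. -/
def partialTransposeChoi (S : Finset ι)
    (W : Matrix ((∀ i, A i) × (∀ i, A' i)) ((∀ i, A i) × (∀ i, A' i)) ℂ) :
    Matrix ((∀ i, A i) × (∀ i, A' i)) ((∀ i, A i) × (∀ i, A' i)) ℂ :=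
  Matrix.of fun p q => W (S.piecewise q.1 p.1, S.piecewise q.2 p.2)
    (S.piecewise p.1 q.1, S.piecewise p.2 q.2)

/-- The involution on pairs of labels that underlies the partial transpose. -/
def exchange (A : ι → Type*) (S : Finset ι) : (∀ i, A i) × (∀ i, A i) ≃ (∀ i, A i) × (∀ i, A i) where
  toFun p := (S.piecewise p.2 p.1, S.piecewise p.1 p.2)
  invFun p := (S.piecewise p.2 p.1, S.piecewise p.1 p.2)
  left_inv _ := Prod.ext (piecewise_piecewise_swap S _ _) (piecewise_piecewise_swap S _ _)
  right_inv _ := Prod.ext (piecewise_piecewise_swap S _ _) (piecewise_piecewise_swap S _ _)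

theorem sum_exchange [∀ i, Fintype (A i)] (S : Finset ι)
    (f : (∀ i, A i) → (∀ i, A i) → ℂ) :
    ∑ x, ∑ y, f (S.piecewise y x) (S.piecewise x y) = ∑ x, ∑ y, f x y := by
  rw [← Fintype.sum_prod_type', ← Fintype.sum_prod_type']
  exact (exchange A S).sum_comp fun p => f p.1 p.2

theorem sum_exchange_prod [∀ i, Fintype (A i)] [∀ i, Fintype (A' i)] (S : Finset ι)
    (f : (∀ i, A i) × (∀ i, A' i) → (∀ i, A i) × (∀ i, A' i) → ℂ) :
    ∑ z : (∀ i, A i) × (∀ i, A' i), ∑ z' : (∀ i, A i) × (∀ i, A' i),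
      f (S.piecewise z'.1 z.1, S.piecewise z'.2 z.2) (S.piecewise z.1 z'.1, S.piecewise z.2 z'.2)
      = ∑ z, ∑ z', f z z' := by
  simp only [Fintype.sum_prod_type]
  have h : ∀ g : (∀ i, A i) → (∀ i, A' i) → (∀ i, A i) → (∀ i, A' i) → ℂ,
      ∑ a, ∑ c, ∑ a', ∑ c', g a c a' c' = ∑ a, ∑ a', ∑ c, ∑ c', g a c a' c' := fun g =>
    Finset.sum_congr rfl fun a _ => Finset.sum_comm
  rw [h, h, ← sum_exchange S]
  exact Finset.sum_congr rfl fun a _ => Finset.sum_congr rfl fun a' _ =>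
    (sum_exchange S fun c c' => f (S.piecewise (S.piecewise a a') (S.piecewise a' a), c)
      (S.piecewise (S.piecewise a' a) (S.piecewise a a'), c')).trans
      (by simp only [piecewise_piecewise_swap])

theorem partialTranspose_comp_ofChoi [∀ i, Fintype (A i)] (S : Finset ι)
    (J : Matrix ((∀ i, A i) × (∀ i, A' i)) ((∀ i, A i) × (∀ i, A' i)) ℂ) :
    partialTranspose S ∘ₗ ofChoi J ∘ₗ partialTranspose S = ofChoi (partialTransposeChoi S J) := by
  refine LinearMap.ext fun X => ?_
  ext d d'
  simp only [LinearMap.comp_apply, partialTranspose_apply, ofChoi_apply, partialTransposeChoi,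
    of_apply]
  rw [← sum_exchange S]
  simp only [piecewise_piecewise_swap]

/-- A set of parties and its complement give equivalent positivity conditions, since the full
transpose preserves positivity. -/
theorem partialTransposeChoi_compl (S : Finset ι)
    (J : Matrix ((∀ i, A i) × (∀ i, A' i)) ((∀ i, A i) × (∀ i, A' i)) ℂ) :
    partialTransposeChoi Sᶜ J = (partialTransposeChoi S J)ᵀ := by
  ext p q
  simp [partialTransposeChoi, Finset.piecewise_compl]

omit [Fintype ι] in
theorem partialTransposeChoi_empty
    (J : Matrix ((∀ i, A i) × (∀ i, A' i)) ((∀ i, A i) × (∀ i, A' i)) ℂ) :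
    partialTransposeChoi ∅ J = J := by
  ext; simp [partialTransposeChoi]

variable [∀ i, Fintype (A i)] [∀ i, Fintype (A' i)] [∀ i, DecidableEq (A i)]
  [∀ i, DecidableEq (R i)]

/-- The operator on the resource systems obtained by pairing the Choi matrix of `P` with an
operator `W` on the input and output systems. -/
def resourcePairing
    (P : Matrix (∀ i, A i × R i) (∀ i, A i × R i) ℂ →ₗ[ℂ] Matrix (∀ i, A' i) (∀ i, A' i) ℂ) :
    Matrix ((∀ i, A i) × (∀ i, A' i)) ((∀ i, A i) × (∀ i, A' i)) ℂ →ₗ[ℂ]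
      Matrix (∀ i, R i) (∀ i, R i) ℂ where
  toFun W := Matrix.of fun r' r => ∑ z, ∑ z',
    P (single (fun i => (z.1 i, r i)) (fun i => (z'.1 i, r' i)) 1) z.2 z'.2 * W z z'
  map_add' _ _ := by ext; simp [mul_add, Finset.sum_add_distrib]
  map_smul' _ _ := by ext; simp [Finset.mul_sum, mul_left_comm]

variable {P : Matrix (∀ i, A i × R i) (∀ i, A i × R i) ℂ →ₗ[ℂ] Matrix (∀ i, A' i) (∀ i, A' i) ℂ}
  {W : Matrix ((∀ i, A i) × (∀ i, A' i)) ((∀ i, A i) × (∀ i, A' i)) ℂ}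

theorem resourcePairing_apply (r' r) : resourcePairing P W r' r = ∑ z, ∑ z',
    P (single (fun i => (z.1 i, r i)) (fun i => (z'.1 i, r' i)) 1) z.2 z'.2 * W z z' := rfl

/-- Exchanging the S-parts of the summed labels only permutes the terms, so the transpose on the
resource moves onto P and W. PPT conditions on P thus become PPT conditions on resource operators.
-/
theorem partialTranspose_resourcePairing (S : Finset ι) :
    partialTranspose S (resourcePairing P W) =
      resourcePairing (partialTranspose S ∘ₗ P ∘ₗ partialTranspose S)
        (partialTransposeChoi S W) := by
  ext r' r
  simp only [partialTranspose_apply, resourcePairing_apply, LinearMap.comp_apply,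
    partialTranspose_single, piecewise_prodMk, partialTransposeChoi, of_apply]
  exact (sum_exchange_prod S (fun z z' => P (single
    (fun i => (z.1 i, S.piecewise r' r i)) (fun i => (z'.1 i, S.piecewise r r' i)) 1) z.2 z'.2
      * W z z')).symm

variable [∀ i, Fintype (R i)]

theorem posSemidef_resourcePairing (hP : IsCP P) (hW : W.PosSemidef) :
    (resourcePairing P W).PosSemidef := by
  have h := posSemidef_sum_sum (Y := ∀ i, R i) (Z := (∀ i, A i) × (∀ i, A' i))
    ((hP.posSemidef_choi.submatrix (fun p : (∀ i, R i) × ((∀ i, A i) × (∀ i, A' i)) =>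
      ((fun i => (p.2.1 i, p.1 i) : ∀ i, A i × R i), p.2.2))).hadamard (hW.submatrix Prod.snd))
  -- Row and column labels are exchanged in `resourcePairing`, so that pairing with ρ becomes Tr[ρ
  -- ·].
  exact h.transpose

theorem partialTranspose_resourcePairing_nonneg {S : Finset ι}
    (hP : IsCP (partialTranspose S ∘ₗ P ∘ₗ partialTranspose S))
    (hW : (partialTransposeChoi S W).PosSemidef) :
    0 ≤ partialTranspose S (resourcePairing P W) := by
  rw [partialTranspose_resourcePairing]
  exact nonneg_iff_posSemidef.2 (posSemidef_resourcePairing hP hW)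

omit [∀ i, DecidableEq (A i)] [∀ i, DecidableEq (R i)] in
theorem isChannel_tensorResource {ρ : Matrix (∀ i, R i) (∀ i, R i) ℂ} (hρ : IsState ρ) :
    IsChannel (tensorResource ρ :
      Matrix (∀ i, A i) (∀ i, A i) ℂ →ₗ[ℂ] Matrix (∀ i, A i × R i) (∀ i, A i × R i) ℂ) := by
  refine ⟨fun n X hX => ?_, fun X => ?_⟩
  · exact (hX.submatrix (fun p : Fin n × (∀ i, A i × R i) => (p.1, fun i => (p.2 i).1))).hadamard
      (hρ.1.submatrix (fun p : Fin n × (∀ i, A i × R i) => fun i => (p.2 i).2))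
  · have h : ∑ x : ∀ i, A i × R i, X (fun i => (x i).1) (fun i => (x i).1) *
        ρ (fun i => (x i).2) (fun i => (x i).2) = ∑ p : (∀ i, A i) × (∀ i, R i),
        X p.1 p.1 * ρ p.2 p.2 :=
      (Equiv.arrowProdEquivProdArrow ι A R).sum_comp fun p => X p.1 p.1 * ρ p.2 p.2
    have h2 := hρ.2
    simp only [trace, diag_apply] at h2 ⊢
    refine h.trans ?_
    simp [Fintype.sum_prod_type, ← Finset.mul_sum, h2]

theorem IsChannel.comp {C D E : Type*} [Fintype C] [Fintype D] [Fintype E]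
    {Φ : Matrix C C ℂ →ₗ[ℂ] Matrix D D ℂ} {Ψ : Matrix D D ℂ →ₗ[ℂ] Matrix E E ℂ}
    (hΨ : IsChannel Ψ) (hΦ : IsChannel Φ) : IsChannel (Ψ ∘ₗ Φ) :=
  ⟨fun n X hX => hΨ.1 n _ (hΦ.1 n X hX), fun X => (hΨ.2 _).trans (hΦ.2 X)⟩

omit [∀ i, Fintype (A i)] in
theorem tensorResource_single (ρ : Matrix (∀ i, R i) (∀ i, R i) ℂ) (a a' : ∀ i, A i) :
    tensorResource ρ (single a a' 1) = ∑ r, ∑ r', ρ r r' •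
      single (fun i => (a i, r i) : ∀ i, A i × R i) (fun i => (a' i, r' i)) 1 := by
  ext x y
  have hx : ∀ (b : ∀ i, A i) (r : ∀ i, R i) (x : ∀ i, A i × R i), (fun i => (b i, r i)) = x ↔
      b = (fun i => (x i).1) ∧ r = fun i => (x i).2 := by
    intro b r x
    simp only [funext_iff, Prod.ext_iff, forall_and]
  simp only [tensorResource, LinearMap.coe_mk, AddHom.coe_mk, of_apply, Matrix.sum_apply,
    Matrix.smul_apply, single, hx, smul_eq_mul]
  by_cases h1 : a = fun i => (x i).1 <;> by_cases h2 : a' = fun i => (y i).1 <;>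
    simp [h1, h2, ite_and]

theorem trace_mul_resourcePairing (ρ : Matrix (∀ i, R i) (∀ i, R i) ℂ) :
    (ρ * resourcePairing P W).trace = ∑ z, ∑ z', choi (P ∘ₗ tensorResource ρ) z z' * W z z' := by
  simp only [trace, diag_apply, Matrix.mul_apply, resourcePairing_apply, choi, of_apply,
    LinearMap.comp_apply, tensorResource_single, map_sum, map_smul, Matrix.sum_apply,
    Matrix.smul_apply, smul_eq_mul, Finset.mul_sum, Finset.sum_mul, mul_assoc]
  rw [sum_sum_comm]

variable [∀ i, DecidableEq (A' i)]

/-- By trace preservation each input label contributes one identity. This is the source of K + L + M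
+ N = 1. -/
theorem resourcePairing_one (hP : ∀ X, (P X).trace = X.trace) :
    resourcePairing P 1 = (Fintype.card (∀ i, A i) : ℂ) • 1 := by
  ext r' r
  have h : ∀ (a : ∀ i, A i), (fun i => (a i, r i) : ∀ i, A i × R i) = (fun i => (a i, r' i)) ↔
      r' = r := by
    intro a
    simp [funext_iff, eq_comm]
  simp only [resourcePairing_apply, Matrix.one_apply, mul_ite, mul_one, mul_zero,
    Finset.sum_ite_eq, Finset.mem_univ, if_true, Fintype.sum_prod_type]
  have h2 : ∀ a : ∀ i, A i, ∑ c, P (single (fun i => (a i, r i)) (fun i => (a i, r' i)) 1) c c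
      = if r' = r then 1 else 0 := by
    intro a
    refine (hP _).trans ?_
    split_ifs with h1
    · rw [(h a).2 h1, trace_single_eq_same]
    · rw [trace_single_eq_of_ne _ _ _ (mt (h a).1 h1)]
  simp [h2, Matrix.one_apply]

end Multipartite

/-! ### Choi matrices of measure-and-apply maps. -/

section ResourceChoi

variable {ι : Type*} {A A' R : ι → Type*}

/-- The Choi matrix of the map that measures the resource systems with the effect `K` and then
applies the map with Choi matrix `W`. -/
def resourceChoi (K : Matrix (∀ i, R i) (∀ i, R i) ℂ)
    (W : Matrix ((∀ i, A i) × (∀ i, A' i)) ((∀ i, A i) × (∀ i, A' i)) ℂ) :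
    Matrix ((∀ i, A i × R i) × (∀ i, A' i)) ((∀ i, A i × R i) × (∀ i, A' i)) ℂ :=
  Matrix.of fun p q => K (fun i => (q.1 i).2) (fun i => (p.1 i).2) *
    W (fun i => (p.1 i).1, p.2) (fun i => (q.1 i).1, q.2)

variable {K : Matrix (∀ i, R i) (∀ i, R i) ℂ}
  {W : Matrix ((∀ i, A i) × (∀ i, A' i)) ((∀ i, A i) × (∀ i, A' i)) ℂ}

theorem resourceChoi_apply (p q) : resourceChoi K W p q =
    K (fun i => (q.1 i).2) (fun i => (p.1 i).2) *
      W (fun i => (p.1 i).1, p.2) (fun i => (q.1 i).1, q.2) := rfl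

theorem posSemidef_resourceChoi (hK : K.PosSemidef) (hW : W.PosSemidef) :
    (resourceChoi K W).PosSemidef :=
  (hK.transpose.submatrix fun p : (∀ i, A i × R i) × (∀ i, A' i) => fun i => (p.1 i).2).hadamard
    (hW.submatrix fun p : (∀ i, A i × R i) × (∀ i, A' i) => (fun i => (p.1 i).1, p.2))

theorem partialTransposeChoi_resourceChoi [DecidableEq ι] (S : Finset ι) :
    partialTransposeChoi S (resourceChoi K W) =
      resourceChoi (partialTranspose S K) (partialTransposeChoi S W) := by
  ext p q
  simp only [partialTransposeChoi, resourceChoi_apply, of_apply, partialTranspose_apply,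
    fst_piecewise, snd_piecewise]

/-- The transposed labels of K in `resourceChoi` make its contraction with ρ the outcome probability
Tr[ρK]. -/
theorem ofChoi_resourceChoi_comp_tensorResource [Fintype ι] [DecidableEq ι] [∀ i, Fintype (A i)]
    [∀ i, Fintype (R i)] (ρ : Matrix (∀ i, R i) (∀ i, R i) ℂ) :
    ofChoi (resourceChoi K W) ∘ₗ tensorResource ρ = (ρ * K).trace • ofChoi W := by
  refine LinearMap.ext fun X => ?_
  ext c c'
  let e := Equiv.arrowProdEquivProdArrow ι A R
  have h : ∀ f : ((∀ i, A i) × (∀ i, R i)) → ((∀ i, A i) × (∀ i, R i)) → ℂ,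
      ∑ x : ∀ i, A i × R i, ∑ y : ∀ i, A i × R i, f (e x) (e y) = ∑ a, ∑ b, f a b := by
    intro f
    rw [← e.sum_comp]
    exact Finset.sum_congr rfl fun x _ => e.sum_comp (f (e x))
  refine (h fun p q => X p.1 q.1 * ρ p.2 q.2 * (K q.2 p.2 * W (p.1, c) (q.1, c'))).trans ?_
  simp only [LinearMap.smul_apply, Matrix.smul_apply, ofChoi_apply, smul_eq_mul, trace, diag_apply,
    Matrix.mul_apply, Fintype.sum_prod_type, Finset.mul_sum, Finset.sum_mul]
  refine (Finset.sum_congr rfl fun a _ => Finset.sum_comm).trans ?_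
  refine Finset.sum_congr rfl fun a _ => Finset.sum_congr rfl fun a' _ =>
    Finset.sum_congr rfl fun r _ => Finset.sum_congr rfl fun r' _ => by ring

end ResourceChoi

/-! ### Maximally entangled projector and flip. -/

section Bipartite

variable (d : ℕ)

/-- The unnormalized maximally entangled projector on two `d`-dimensional systems. -/
def maxEnt : Matrix (Fin d × Fin d) (Fin d × Fin d) ℂ :=
  Matrix.of fun p q => if p.1 = p.2 ∧ q.1 = q.2 then 1 else 0

/-- The flip operator on two `d`-dimensional systems. -/
def flipOp : Matrix (Fin d × Fin d) (Fin d × Fin d) ℂ :=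
  Matrix.of fun p q => if p.1 = q.2 ∧ q.1 = p.2 then 1 else 0

/-- H = c⁻¹ H H†. It applies to Φ and d·1 - Φ with c = d, and to 1 ± F with c = 2. -/
theorem posSemidef_of_mul_self_eq_smul {X : Type*} [Fintype X] {H : Matrix X X ℂ}
    (hH : H.IsHermitian) {c : ℝ} (hc : 0 < c) (h : H * H = (c : ℂ) • H) : H.PosSemidef := by
  have e : H = ((c⁻¹ : ℝ) : ℂ) • (H * Hᴴ) := by
    rw [hH.eq, h, smul_smul, ← Complex.ofReal_mul, inv_mul_cancel₀ hc.ne', Complex.ofReal_one,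
      one_smul]
  rw [e]
  exact (posSemidef_self_mul_conjTranspose H).smul (by exact_mod_cast (inv_pos.2 hc).le)

theorem maxEnt_isHermitian : (maxEnt d).IsHermitian := by
  ext p q
  simp [maxEnt, and_comm, apply_ite]

theorem flipOp_isHermitian : (flipOp d).IsHermitian := by
  ext p q
  simp [flipOp, and_comm]

theorem maxEnt_mul_self : maxEnt d * maxEnt d = (d : ℂ) • maxEnt d := by
  ext p q
  by_cases h1 : p.1 = p.2 <;> by_cases h2 : q.1 = q.2 <;>
    simp [maxEnt, Matrix.mul_apply, Fintype.sum_prod_type, h1, h2]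

theorem flipOp_mul_self : flipOp d * flipOp d = 1 := by
  ext ⟨i, j⟩ ⟨k, l⟩
  simp only [flipOp, Matrix.mul_apply, of_apply, Fintype.sum_prod_type, Matrix.one_apply,
    Prod.mk.injEq, ite_and, mul_ite, mul_one, mul_zero]
  by_cases h1 : i = k <;> by_cases h2 : j = l <;> simp [h1, h2, eq_comm]

theorem maxEnt_mul_maxEnt_apply {d : ℕ} (i j i' j' k l k' l' : Fin d) {p : Prop} [Decidable p]
    (h : p ↔ (i = j ∧ i' = j') ∧ (k = l ∧ k' = l')) :
    maxEnt d (i, j) (i', j') * maxEnt d (k, l) (k', l') = if p then 1 else 0 := by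
  rw [if_congr h rfl rfl, ite_and (_ ∧ _)]
  simp only [maxEnt, of_apply]
  split_ifs <;> simp

theorem one_mul_one_apply {d : ℕ} (i j i' j' k l k' l' : Fin d) {p : Prop} [Decidable p]
    (h : p ↔ (i = i' ∧ j = j') ∧ (k = k' ∧ l = l')) :
    (1 : Matrix (Fin d × Fin d) (Fin d × Fin d) ℂ) (i, j) (i', j') *
      (1 : Matrix (Fin d × Fin d) (Fin d × Fin d) ℂ) (k, l) (k', l') = if p then 1 else 0 := by
  rw [if_congr h rfl rfl, ite_and (_ ∧ _)]
  simp only [Matrix.one_apply, Prod.mk.injEq]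
  split_ifs <;> simp

theorem posSemidef_maxEnt (hd : 0 < d) : (maxEnt d).PosSemidef :=
  posSemidef_of_mul_self_eq_smul (maxEnt_isHermitian d) (c := d) (by exact_mod_cast hd)
    (by simpa using maxEnt_mul_self d)

theorem posSemidef_smul_one_sub_maxEnt (hd : 0 < d) :
    ((d : ℂ) • 1 - maxEnt d).PosSemidef := by
  refine posSemidef_of_mul_self_eq_smul ?_ (c := d) (by exact_mod_cast hd) ?_
  · rw [IsHermitian, conjTranspose_sub, (maxEnt_isHermitian d).eq]
    simp
  · simp only [Matrix.sub_mul, Matrix.mul_sub, maxEnt_mul_self, Matrix.smul_mul, Matrix.one_mul,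
      Matrix.mul_smul, Matrix.mul_one, Complex.ofReal_natCast, smul_sub]
    abel

theorem posSemidef_one_add_flipOp : (1 + flipOp d).PosSemidef := by
  refine posSemidef_of_mul_self_eq_smul ?_ (c := 2) (by norm_num) ?_
  · rw [IsHermitian, conjTranspose_add, (flipOp_isHermitian d).eq, conjTranspose_one]
  · simp only [Matrix.add_mul, Matrix.mul_add, flipOp_mul_self, Matrix.one_mul, Matrix.mul_one]
    push_cast
    rw [two_smul]
    abel

theorem posSemidef_one_sub_flipOp : (1 - flipOp d).PosSemidef := by
  refine posSemidef_of_mul_self_eq_smul ?_ (c := 2) (by norm_num) ?_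
  · rw [IsHermitian, conjTranspose_sub, (flipOp_isHermitian d).eq, conjTranspose_one]
  · simp only [Matrix.sub_mul, Matrix.mul_sub, flipOp_mul_self, Matrix.one_mul, Matrix.mul_one]
    push_cast
    rw [two_smul]
    abel

end Bipartite

/-! ### The swap channel and its Choi matrix. -/

section Swap

variable {d : ℕ}

/-- The labels of the inputs and outputs of the swap channel, grouped into Alice's input with Bob's
output and Bob's input with Alice's output. -/
def pairLabels (d : ℕ) (z : (∀ p, SwapSys d p) × (∀ p, SwapSys d p)) :
    (Fin d × Fin d) × (Fin d × Fin d) :=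
  ((z.1 .alice, z.2 .bob), (z.1 .bob, z.2 .alice))

/-- The operator on the inputs and outputs of the swap channel that is `g` on Alice's input and
Bob's output, and `h` on Bob's input and Alice's output. -/
def swapTensor (g h : Matrix (Fin d × Fin d) (Fin d × Fin d) ℂ) :
    Matrix ((∀ p, SwapSys d p) × (∀ p, SwapSys d p)) ((∀ p, SwapSys d p) × (∀ p, SwapSys d p)) ℂ :=
  (kroneckerMap (· * ·) g h).submatrix (pairLabels d) (pairLabels d)

theorem posSemidef_swapTensor {g h : Matrix (Fin d × Fin d) (Fin d × Fin d) ℂ}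
    (hg : g.PosSemidef) (hh : h.PosSemidef) : (swapTensor g h).PosSemidef :=
  (hg.kronecker hh).submatrix _

theorem swapTensor_apply (g h : Matrix (Fin d × Fin d) (Fin d × Fin d) ℂ) (z z') :
    swapTensor g h z z' = g (z.1 .alice, z.2 .bob) (z'.1 .alice, z'.2 .bob) *
      h (z.1 .bob, z.2 .alice) (z'.1 .bob, z'.2 .alice) := rfl

/-- The labels of the swap channel in terms of those of Alice and Bob. -/
def swapLabelEquiv (d : ℕ) : (∀ p, SwapSys d p) ≃ Fin d × Fin d where
  toFun x := (x .alice, x .bob)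
  invFun q := fun p => match p with
    | .alice => q.1
    | .bob => q.2
    | .charlie => (0 : Fin 1)
  left_inv x := by
    funext p
    cases p
    · rfl
    · rfl
    · exact Subsingleton.elim (α := Fin 1) _ _
  right_inv _ := rfl

theorem swapLabel_ext_iff {x y : ∀ p, SwapSys d p} :
    x = y ↔ x .alice = y .alice ∧ x .bob = y .bob := by
  rw [← (swapLabelEquiv d).injective.eq_iff, Prod.ext_iff]
  rfl

theorem sum_swapLabel (f : Fin d → Fin d → ℂ) :
    ∑ x : ∀ p, SwapSys d p, f (x .alice) (x .bob) = ∑ i, ∑ j, f i j := by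
  rw [← Fintype.sum_prod_type']
  exact (swapLabelEquiv d).sum_comp fun p => f p.1 p.2

theorem card_swapLabel (d : ℕ) : Fintype.card (∀ p, SwapSys d p) = d ^ 2 := by
  rw [Fintype.card_congr (swapLabelEquiv d)]
  simp [sq]

theorem swapTensor_one_one : swapTensor (1 : Matrix (Fin d × Fin d) (Fin d × Fin d) ℂ) 1 = 1 := by
  ext z z'
  rw [Matrix.one_apply]
  refine one_mul_one_apply _ _ _ _ _ _ _ _ ?_
  rw [Prod.ext_iff, swapLabel_ext_iff, swapLabel_ext_iff]
  tauto

theorem flipLabel_flipLabel (x : ∀ p, SwapSys d p) : flipLabel d (flipLabel d x) = x :=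
  swapLabel_ext_iff.2 ⟨rfl, rfl⟩

theorem eq_flipLabel_iff {x y : ∀ p, SwapSys d p} :
    x = flipLabel d y ↔ x .alice = y .bob ∧ x .bob = y .alice := swapLabel_ext_iff

theorem swapChannel_apply (ω : Matrix (∀ p, SwapSys d p) (∀ p, SwapSys d p) ℂ) (x y) :
    swapChannel d ω x y = ω (flipLabel d x) (flipLabel d y) := by
  have h : ∀ x y : ∀ p, SwapSys d p, x = flipLabel d y ↔ flipLabel d x = y := fun x y =>
    ⟨fun h => by rw [h, flipLabel_flipLabel], fun h => by rw [← h, flipLabel_flipLabel]⟩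
  change (swapOp d * ω * (swapOp d)ᴴ) x y = _
  simp [Matrix.mul_apply, swapOp, h, apply_ite]

theorem isChannel_swapChannel : IsChannel (swapChannel d) := by
  refine ⟨fun n X hX => ?_, fun X => ?_⟩
  · have e : ampliate (Fin n) (swapChannel d) X =
        X.submatrix (fun p => (p.1, flipLabel d p.2)) (fun p => (p.1, flipLabel d p.2)) := by
      ext p q
      simp [ampliate, swapChannel_apply]
    rw [e]
    exact hX.submatrix _
  · simp only [trace, diag_apply, swapChannel_apply]
    exact Equiv.sum_comp ⟨flipLabel d, flipLabel d, flipLabel_flipLabel, flipLabel_flipLabel⟩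
      fun x => X x x

theorem choi_swapChannel : choi (swapChannel d) = swapTensor (maxEnt d) (maxEnt d) := by
  ext ⟨a, c⟩ ⟨a', c'⟩
  change swapChannel d (single a a' 1) c c' = _
  rw [swapChannel_apply, single, of_apply]
  refine (maxEnt_mul_maxEnt_apply _ _ _ _ _ _ _ _ ?_).symm
  rw [eq_flipLabel_iff, eq_flipLabel_iff]
  tauto

/-- Transpose of the first system. -/
def transposeFst (g : Matrix (Fin d × Fin d) (Fin d × Fin d) ℂ) :
    Matrix (Fin d × Fin d) (Fin d × Fin d) ℂ :=
  Matrix.of fun p q => g (q.1, p.2) (p.1, q.2)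

/-- Transpose of the second system. -/
def transposeSnd (g : Matrix (Fin d × Fin d) (Fin d × Fin d) ℂ) :
    Matrix (Fin d × Fin d) (Fin d × Fin d) ℂ :=
  Matrix.of fun p q => g (p.1, q.2) (q.1, p.2)

theorem transposeFst_maxEnt : transposeFst (maxEnt d) = flipOp d := by
  ext p q
  simp [transposeFst, maxEnt, flipOp, and_comm]

theorem transposeSnd_maxEnt : transposeSnd (maxEnt d) = flipOp d := by
  ext p q
  simp [transposeSnd, maxEnt, flipOp]

theorem transposeFst_one : transposeFst (1 : Matrix (Fin d × Fin d) (Fin d × Fin d) ℂ) = 1 := by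
  ext p q
  simp [transposeFst, Matrix.one_apply, Prod.ext_iff, eq_comm]

theorem transposeSnd_one : transposeSnd (1 : Matrix (Fin d × Fin d) (Fin d × Fin d) ℂ) = 1 := by
  ext p q
  simp [transposeSnd, Matrix.one_apply, Prod.ext_iff, eq_comm]

theorem partialTransposeChoi_alice (g h : Matrix (Fin d × Fin d) (Fin d × Fin d) ℂ) :
    partialTransposeChoi {Party.alice} (swapTensor g h)
      = swapTensor (transposeFst g) (transposeSnd h) := by
  ext z z'
  simp [partialTransposeChoi, swapTensor_apply, transposeFst, transposeSnd, Finset.piecewise]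

theorem partialTransposeChoi_bob (g h : Matrix (Fin d × Fin d) (Fin d × Fin d) ℂ) :
    partialTransposeChoi {Party.bob} (swapTensor g h)
      = swapTensor (transposeSnd g) (transposeFst h) := by
  ext z z'
  simp [partialTransposeChoi, swapTensor_apply, transposeFst, transposeSnd, Finset.piecewise]

theorem partialTransposeChoi_charlie (g h : Matrix (Fin d × Fin d) (Fin d × Fin d) ℂ) :
    partialTransposeChoi {Party.charlie} (swapTensor g h) = swapTensor g h := by
  ext z z'
  simp [partialTransposeChoi, swapTensor_apply, Finset.piecewise]

end Swap

/-! ### Converse: feasible operators from an arbitrary simulation. -/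

section Lower

variable {d : ℕ}

theorem posSemidef_one_add_smul_flipOp {s : ℂ} (hs : s = 1 ∨ s = -1) :
    ((1 : Matrix (Fin d × Fin d) (Fin d × Fin d) ℂ) + s • flipOp d).PosSemidef := by
  rcases hs with rfl | rfl
  · simpa using posSemidef_one_add_flipOp d
  · simpa [← sub_eq_add_neg] using posSemidef_one_sub_flipOp d

theorem transposeFst_one_add (s : ℂ) :
    transposeFst (1 + s • maxEnt d) = 1 + s • flipOp d := by
  conv_rhs => rw [← transposeFst_maxEnt, ← transposeFst_one]
  rfl

theorem transposeSnd_one_add (s : ℂ) :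
    transposeSnd (1 + s • maxEnt d) = 1 + s • flipOp d := by
  conv_rhs => rw [← transposeSnd_maxEnt, ← transposeSnd_one]
  rfl

/-- Each tensor factor contains one system of Alice and one of Bob, so either party's transpose
turns Φ into F in both. -/
theorem partialTransposeChoi_swapTensor {p : Party} (hp : p ∈ ({.alice, .bob} : Set Party))
    (s t : ℂ) :
    partialTransposeChoi {p} (swapTensor (1 + s • maxEnt d) (1 + t • maxEnt d)) =
      swapTensor (1 + s • flipOp d) (1 + t • flipOp d) := by
  rcases hp with rfl | rfl
  · rw [partialTransposeChoi_alice, transposeFst_one_add, transposeSnd_one_add]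
  · rw [partialTransposeChoi_bob, transposeFst_one_add, transposeSnd_one_add]

variable {R : Party → Type*} [∀ p, Fintype (R p)] [∀ p, DecidableEq (R p)]
  {P : Matrix (∀ p, SwapSys d p × R p) (∀ p, SwapSys d p × R p) ℂ →ₗ[ℂ]
    Matrix (∀ p, SwapSys d p) (∀ p, SwapSys d p) ℂ}

theorem IsCPPTP.partialTranspose_nonneg (hP : IsCPPTP P) {p : Party}
    (hp : p ∈ ({.alice, .bob} : Set Party)) {s t : ℂ} (hs : s = 1 ∨ s = -1) (ht : t = 1 ∨ t = -1) :
    0 ≤ partialTranspose {p} (resourcePairing P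
      (swapTensor (1 + s • maxEnt d) (1 + t • maxEnt d))) := by
  refine partialTranspose_resourcePairing_nonneg (hP.2 {p}) ?_
  rw [partialTransposeChoi_swapTensor hp]
  exact posSemidef_swapTensor (posSemidef_one_add_smul_flipOp hs) (posSemidef_one_add_smul_flipOp ht)

/-- The weighted pairing of `P` with products of the maximally entangled projector (for `true`) or
its complement (for `false`). -/
noncomputable def twirlPart (P : Matrix (∀ p, SwapSys d p × R p) (∀ p, SwapSys d p × R p) ℂ →ₗ[ℂ]
    Matrix (∀ p, SwapSys d p) (∀ p, SwapSys d p) ℂ) (x y : Bool) :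
    Matrix (∀ p, R p) (∀ p, R p) ℂ :=
  let g : Bool → Matrix (Fin d × Fin d) (Fin d × Fin d) ℂ := fun x =>
    (d : ℂ)⁻¹ • if x then maxEnt d else (d : ℂ) • 1 - maxEnt d
  resourcePairing P (((d : ℂ) ^ 2)⁻¹ • swapTensor (g x) (g y))

-- Expand both factors by 1 + sΦ = (1 + sd) Φ/d + (1 - Φ/d).
omit [∀ p, Fintype (R p)] in
theorem resourcePairing_swapTensor_eq (hd : 0 < d) (s t : ℂ) :
    resourcePairing P (swapTensor (1 + s • maxEnt d) (1 + t • maxEnt d)) =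
      (d : ℂ) ^ 2 • (((1 + s * d) * (1 + t * d)) • twirlPart P true true
        + (1 + s * d) • twirlPart P true false + (1 + t * d) • twirlPart P false true
        + twirlPart P false false) := by
  have hd' : (d : ℂ) ≠ 0 := by exact_mod_cast hd.ne'
  simp only [twirlPart, ← map_smul, ← map_add, if_true, Bool.false_eq_true, if_false]
  congr 1
  ext z z'
  simp only [swapTensor_apply, Matrix.add_apply, Matrix.smul_apply, Matrix.sub_apply, smul_eq_mul]
  field_simp
  ring

theorem partialTranspose_twirlPart_nonneg (hd : 0 < d) (hP : IsCPPTP P) {p : Party}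
    (hp : p ∈ ({.alice, .bob} : Set Party)) {s t : ℝ} (hs : s = 1 ∨ s = -1) (ht : t = 1 ∨ t = -1)
    {c : ℝ} (hc : 0 ≤ c) :
    0 ≤ c • partialTranspose {p} (((1 + s * d) * (1 + t * d)) • twirlPart P true true
        + (1 + s * d) • twirlPart P true false + (1 + t * d) • twirlPart P false true
        + twirlPart P false false) := by
  have hd' : (d : ℂ) ≠ 0 := by exact_mod_cast hd.ne'
  have h := hP.partialTranspose_nonneg hp (s := s) (t := t)
    (by rcases hs with rfl | rfl <;> simp) (by rcases ht with rfl | rfl <;> simp)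
  rw [resourcePairing_swapTensor_eq hd] at h
  have h2 := nonneg_iff_posSemidef.2 ((nonneg_iff_posSemidef.1 h).smul
    (a := (c : ℂ) * ((d : ℂ) ^ 2)⁻¹)
    (by rw [← Complex.ofReal_natCast, ← Complex.ofReal_pow, ← Complex.ofReal_inv,
      ← Complex.ofReal_mul]; exact_mod_cast by positivity))
  convert h2 using 1
  ext r r'
  simp only [partialTranspose_apply, Matrix.add_apply, Matrix.smul_apply, smul_eq_mul,
    Complex.real_smul]
  push_cast
  field_simp

/-- The four mixed constraints are the tests (s, t) = (1, 1), (1, -1), (-1, 1), (-1, -1), each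
divided by |(1 + sd)(1 + td)|. -/
theorem twirlPart_feasible (hd : 2 ≤ d) (hP : IsCPPTP P) :
    SwapFeasible d (twirlPart P true true) (twirlPart P true false) (twirlPart P false true)
      (twirlPart P false false) := by
  have hd0 : 0 < d := by omega
  have hdc : (d : ℂ) ≠ 0 := by exact_mod_cast hd0.ne'
  have hd2 : (2 : ℝ) ≤ d := by exact_mod_cast hd
  have h1 : (d : ℂ) + 1 ≠ 0 := by exact_mod_cast (by omega : d + 1 ≠ 0)
  have h2 : (d : ℂ) - 1 ≠ 0 := by
    rw [sub_ne_zero]; exact_mod_cast (by omega : d ≠ 1)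
  have hinv : 0 ≤ (d : ℂ)⁻¹ := by
    rw [← Complex.ofReal_natCast, ← Complex.ofReal_inv]; exact_mod_cast by positivity
  have hW : ∀ x y : Bool, (((d : ℂ) ^ 2)⁻¹ • swapTensor
      ((d : ℂ)⁻¹ • if x then maxEnt d else (d : ℂ) • 1 - maxEnt d)
      ((d : ℂ)⁻¹ • if y then maxEnt d else (d : ℂ) • 1 - maxEnt d)).PosSemidef := by
    have hg : ∀ x : Bool,
        ((d : ℂ)⁻¹ • if x then maxEnt d else (d : ℂ) • 1 - maxEnt d).PosSemidef := by
      intro x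
      cases x
      · exact (posSemidef_smul_one_sub_maxEnt d hd0).smul hinv
      · exact (posSemidef_maxEnt d hd0).smul hinv
    intro x y
    refine (posSemidef_swapTensor (hg x) (hg y)).smul ?_
    rw [← inv_pow]
    exact pow_nonneg hinv 2
  have hnn : ∀ x y, 0 ≤ twirlPart P x y := fun x y =>
    nonneg_iff_posSemidef.2 (posSemidef_resourcePairing hP.1.1 (hW x y))
  have hC : ∀ x y, 0 ≤ partialTranspose {Party.charlie} (twirlPart P x y) := by
    intro x y
    refine partialTranspose_resourcePairing_nonneg (hP.2 _) ?_
    have e := partialTransposeChoi_charlie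
      ((d : ℂ)⁻¹ • if x then maxEnt d else (d : ℂ) • 1 - maxEnt d)
      ((d : ℂ)⁻¹ • if y then maxEnt d else (d : ℂ) • 1 - maxEnt d)
    have e2 := hW x y
    rw [← e] at e2
    exact e2
  have hsum : twirlPart P true true + twirlPart P true false + twirlPart P false true
      + twirlPart P false false = 1 := by
    -- At s = t = 0 the test operator is the identity, so `resourcePairing_one` applies.
    have e := resourcePairing_swapTensor_eq (P := P) hd0 0 0
    simp only [zero_smul, add_zero, zero_mul, mul_one, one_smul, swapTensor_one_one] at e
    rw [resourcePairing_one hP.1.2, card_swapLabel, Nat.cast_pow] at e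
    exact (smul_right_injective _ (pow_ne_zero 2 hdc) e).symm
  refine ⟨hnn _ _, hnn _ _, hnn _ _, hnn _ _, hsum, ?_, ?_, ?_, ?_, hC _ _, hC _ _, hC _ _, hC _ _⟩
  · intro p hp
    convert partialTranspose_twirlPart_nonneg hd0 hP hp (s := 1) (t := 1) (c := (1 / ((d : ℝ) + 1)) ^ 2)
      (Or.inl rfl) (Or.inl rfl) (by positivity) using 1
    ext r r'
    simp only [partialTranspose_apply, Matrix.add_apply, Matrix.smul_apply, Complex.real_smul]
    push_cast
    field_simp
    ring
  · intro p hp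
    rw [← sub_nonneg]
    convert partialTranspose_twirlPart_nonneg hd0 hP hp (s := 1) (t := -1)
      (c := 1 / ((d : ℝ) + 1) * (1 / ((d : ℝ) - 1)))
      (Or.inl rfl) (Or.inr rfl) (mul_nonneg (by positivity) (one_div_nonneg.2 (by linarith))) using 1
    ext r r'
    simp only [partialTranspose_apply, Matrix.add_apply, Matrix.smul_apply, Complex.real_smul,
      Matrix.sub_apply]
    push_cast
    field_simp
    ring
  · intro p hp
    rw [← sub_nonneg]
    convert partialTranspose_twirlPart_nonneg hd0 hP hp (s := -1) (t := 1)
      (c := 1 / ((d : ℝ) + 1) * (1 / ((d : ℝ) - 1)))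
      (Or.inr rfl) (Or.inl rfl) (mul_nonneg (by positivity) (one_div_nonneg.2 (by linarith))) using 1
    ext r r'
    simp only [partialTranspose_apply, Matrix.add_apply, Matrix.smul_apply, Complex.real_smul,
      Matrix.sub_apply]
    push_cast
    field_simp
    ring
  · intro p hp
    rw [← sub_nonneg]
    convert partialTranspose_twirlPart_nonneg hd0 hP hp (s := -1) (t := -1)
      (c := (1 / ((d : ℝ) - 1)) ^ 2)
      (Or.inr rfl) (Or.inr rfl) (by positivity) using 1
    ext r r'
    simp only [partialTranspose_apply, Matrix.add_apply, Matrix.smul_apply, Complex.real_smul,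
      Matrix.sub_apply]
    push_cast
    field_simp
    ring

end Lower

/-! ### Achievability: a simulation from feasible operators. -/

section Upper

variable {d : ℕ} {R : Party → Type*}

/-- The Choi matrix of the universally covariant channel `(d Tr[X] 1 - X) / (d² - 1)`. -/
noncomputable def covChoi (d : ℕ) : Matrix (Fin d × Fin d) (Fin d × Fin d) ℂ :=
  ((d : ℂ) ^ 2 - 1)⁻¹ • ((d : ℂ) • 1 - maxEnt d)

/-- The Choi matrix of the channel that measures the resource and applies, up to the swap, the
identity or the channel of `covChoi` to each of the systems. -/
noncomputable def simChoi (d : ℕ) (K L M N : Matrix (∀ p, R p) (∀ p, R p) ℂ) :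
    Matrix ((∀ p, SwapSys d p × R p) × (∀ p, SwapSys d p))
      ((∀ p, SwapSys d p × R p) × (∀ p, SwapSys d p)) ℂ :=
  resourceChoi K (swapTensor (maxEnt d) (maxEnt d))
    + resourceChoi L (swapTensor (maxEnt d) (covChoi d))
    + resourceChoi M (swapTensor (covChoi d) (maxEnt d))
    + resourceChoi N (swapTensor (covChoi d) (covChoi d))

theorem posSemidef_covChoi (hd : 2 ≤ d) : (covChoi d).PosSemidef := by
  refine (posSemidef_smul_one_sub_maxEnt d (by omega)).smul ?_
  have : (0 : ℝ) ≤ ((d : ℝ) ^ 2 - 1)⁻¹ := by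
    have : (2 : ℝ) ≤ d := by exact_mod_cast hd
    exact inv_nonneg.2 (by nlinarith)
  have h2 : ((((d : ℝ) ^ 2 - 1)⁻¹ : ℝ) : ℂ) = ((d : ℂ) ^ 2 - 1)⁻¹ := by push_cast; rfl
  rw [← h2]
  exact_mod_cast this

theorem posSemidef_simChoi (hd : 2 ≤ d) {K L M N : Matrix (∀ p, R p) (∀ p, R p) ℂ}
    (hK : 0 ≤ K) (hL : 0 ≤ L) (hM : 0 ≤ M) (hN : 0 ≤ N) : (simChoi d K L M N).PosSemidef := by
  have h1 := posSemidef_maxEnt d (by omega)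
  have h2 := posSemidef_covChoi hd
  rw [nonneg_iff_posSemidef] at hK hL hM hN
  exact (((posSemidef_resourceChoi hK (posSemidef_swapTensor h1 h1)).add
    (posSemidef_resourceChoi hL (posSemidef_swapTensor h1 h2))).add
    (posSemidef_resourceChoi hM (posSemidef_swapTensor h2 h1))).add
    (posSemidef_resourceChoi hN (posSemidef_swapTensor h2 h2))

theorem partialTransposeChoi_simChoi (S : Finset Party)
    (K L M N : Matrix (∀ p, R p) (∀ p, R p) ℂ) : partialTransposeChoi S (simChoi d K L M N) =
      resourceChoi (partialTranspose S K)
        (partialTransposeChoi S (swapTensor (maxEnt d) (maxEnt d)))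
      + resourceChoi (partialTranspose S L)
        (partialTransposeChoi S (swapTensor (maxEnt d) (covChoi d)))
      + resourceChoi (partialTranspose S M)
        (partialTransposeChoi S (swapTensor (covChoi d) (maxEnt d)))
      + resourceChoi (partialTranspose S N)
        (partialTransposeChoi S (swapTensor (covChoi d) (covChoi d))) := by
  simp only [← partialTransposeChoi_resourceChoi]
  rfl

/-- The partial transpose of `covChoi` on one system. -/
noncomputable def covFlip (d : ℕ) : Matrix (Fin d × Fin d) (Fin d × Fin d) ℂ :=
  ((d : ℂ) ^ 2 - 1)⁻¹ • ((d : ℂ) • 1 - flipOp d)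

theorem transposeFst_covChoi : transposeFst (covChoi d) = covFlip d := by
  rw [covFlip, ← transposeFst_maxEnt, ← transposeFst_one]
  rfl

theorem transposeSnd_covChoi : transposeSnd (covChoi d) = covFlip d := by
  rw [covFlip, ← transposeSnd_maxEnt, ← transposeSnd_one]
  rfl

theorem partialTransposeChoi_simChoi_single {p : Party} (hp : p ∈ ({.alice, .bob} : Set Party))
    (K L M N : Matrix (∀ p, R p) (∀ p, R p) ℂ) : partialTransposeChoi {p} (simChoi d K L M N) =
      resourceChoi (partialTranspose {p} K) (swapTensor (flipOp d) (flipOp d))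
      + resourceChoi (partialTranspose {p} L) (swapTensor (flipOp d) (covFlip d))
      + resourceChoi (partialTranspose {p} M) (swapTensor (covFlip d) (flipOp d))
      + resourceChoi (partialTranspose {p} N) (swapTensor (covFlip d) (covFlip d)) := by
  rw [partialTransposeChoi_simChoi]
  rcases hp with rfl | rfl
  · simp only [partialTransposeChoi_alice, transposeFst_maxEnt, transposeSnd_maxEnt,
      transposeFst_covChoi, transposeSnd_covChoi]
  · simp only [partialTransposeChoi_bob, transposeFst_maxEnt, transposeSnd_maxEnt,
      transposeFst_covChoi, transposeSnd_covChoi]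

variable [∀ p, Fintype (R p)] [∀ p, DecidableEq (R p)] {K L M N : Matrix (∀ p, R p) (∀ p, R p) ℂ}

/-- Substitute F = ((1 + F) - (1 - F))/2 and (d·1 - F)/(d² - 1) = (1 + F)/(2(d + 1)) + (1 - F)/(2(d
- 1)). The coefficients of the four products are the constraint operators, up to the factor 1/4. -/
theorem SwapFeasible.posSemidef_partialTransposeChoi (hd : 2 ≤ d) (h : SwapFeasible d K L M N)
    {p : Party} (hp : p ∈ ({.alice, .bob} : Set Party)) :
    (partialTransposeChoi {p} (simChoi d K L M N)).PosSemidef := by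
  have h1 : (d : ℂ) + 1 ≠ 0 := by exact_mod_cast (by omega : d + 1 ≠ 0)
  have h2 : (d : ℂ) - 1 ≠ 0 := by
    rw [sub_ne_zero]; exact_mod_cast (by omega : d ≠ 1)
  have hinv : (0 : ℂ) ≤ ((4⁻¹ : ℝ) : ℂ) := Complex.zero_le_real.2 (by norm_num)
  have hps : ∀ {s t : ℂ}, (s = 1 ∨ s = -1) → (t = 1 ∨ t = -1) →
      (swapTensor (1 + s • flipOp d) (1 + t • flipOp d)).PosSemidef := fun hs ht =>
    posSemidef_swapTensor (posSemidef_one_add_smul_flipOp hs) (posSemidef_one_add_smul_flipOp ht)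
  have e1 := posSemidef_resourceChoi (nonneg_iff_posSemidef.1 (h.ppt_one p hp))
    (hps (Or.inl rfl) (Or.inl rfl))
  have e2 := posSemidef_resourceChoi (le_iff.1 (h.ppt_two p hp))
    (hps (Or.inl rfl) (Or.inr rfl))
  have e3 := posSemidef_resourceChoi (le_iff.1 (h.ppt_three p hp))
    (hps (Or.inr rfl) (Or.inl rfl))
  have e4 := posSemidef_resourceChoi (le_iff.1 (h.ppt_four p hp))
    (hps (Or.inr rfl) (Or.inr rfl))
  rw [partialTransposeChoi_simChoi_single hp]
  convert (((e1.add e2).add e3).add e4).smul hinv using 1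
  ext z z'
  simp only [resourceChoi_apply, swapTensor_apply, Matrix.add_apply, Matrix.smul_apply,
    Matrix.sub_apply, smul_eq_mul, covFlip, partialTranspose_apply, Complex.real_smul]
  have h4 : ((d : ℂ) ^ 2 - 1)⁻¹ = (((d : ℂ) + 1) * ((d : ℂ) - 1))⁻¹ := by ring
  rw [h4]
  push_cast
  field_simp
  ring

theorem sum_maxEnt (i i' : Fin d) : ∑ j, maxEnt d (i, j) (i', j) = if i = i' then 1 else 0 := by
  simp [maxEnt, ite_and, eq_comm]

theorem sum_covChoi (hd : 2 ≤ d) (i i' : Fin d) :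
    ∑ j, covChoi d (i, j) (i', j) = if i = i' then 1 else 0 := by
  have h3 : (d : ℂ) ^ 2 - 1 ≠ 0 := by
    have h1 : (d : ℂ) + 1 ≠ 0 := by exact_mod_cast (by omega : d + 1 ≠ 0)
    have h2 : (d : ℂ) - 1 ≠ 0 := by
      rw [sub_ne_zero]; exact_mod_cast (by omega : d ≠ 1)
    have : (d : ℂ) ^ 2 - 1 = (d + 1) * (d - 1) := by ring
    rw [this]; exact mul_ne_zero h1 h2
  simp only [covChoi, Matrix.smul_apply, Matrix.sub_apply, smul_eq_mul, ← Finset.mul_sum,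
    Finset.sum_sub_distrib, sum_maxEnt, Matrix.one_apply, Prod.mk.injEq, and_true]
  split_ifs
  · simp
    field_simp
  · simp

theorem ite_mul_ite {p q r : Prop} [Decidable p] [Decidable q] [Decidable r] (h : r ↔ p ∧ q) :
    (if p then (1 : ℂ) else 0) * (if q then 1 else 0) = if r then 1 else 0 := by
  rw [if_congr h rfl rfl, ite_and]
  split_ifs <;> simp

theorem sum_swapTensor {g h : Matrix (Fin d × Fin d) (Fin d × Fin d) ℂ}
    (hg : ∀ i i', ∑ j, g (i, j) (i', j) = if i = i' then 1 else 0)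
    (hh : ∀ i i', ∑ j, h (i, j) (i', j) = if i = i' then 1 else 0) (a a' : ∀ p, SwapSys d p) :
    ∑ c, swapTensor g h (a, c) (a', c) = if a = a' then 1 else 0 := by
  refine (sum_swapLabel fun i j => g (a .alice, j) (a' .alice, j) *
    h (a .bob, i) (a' .bob, i)).trans ?_
  rw [Finset.sum_comm]
  simp only [← Finset.mul_sum, ← Finset.sum_mul]
  refine (congrArg₂ (· * ·) (hg _ _) (hh _ _)).trans ?_
  have h1 : ∀ (i i' j j' : Fin d), (a = a' ↔ i = i' ∧ j = j') →
      (if i = i' then (1 : ℂ) else 0) * (if j = j' then 1 else 0) = if a = a' then 1 else 0 :=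
    fun i i' j j' => ite_mul_ite
  exact h1 _ _ _ _ swapLabel_ext_iff

-- Trace preservation: Φ and `covChoi d` both have partial trace 1 over the output, leaving K + L +
-- M + N = 1.
omit [∀ p, Fintype (R p)] in
theorem sum_simChoi (hd : 2 ≤ d) (hsum : K + L + M + N = 1) (x x' : ∀ p, SwapSys d p × R p) :
    ∑ c, simChoi d K L M N (x, c) (x', c) = if x = x' then 1 else 0 := by
  have hx : x = x' ↔ (fun i => (x i).1) = (fun i => (x' i).1) ∧
      (fun i => (x' i).2) = (fun i => (x i).2) := by
    simp only [funext_iff, Prod.ext_iff, forall_and, eq_comm]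
  have hE := sum_covChoi hd
  have e := congrFun (congrFun hsum (fun i => (x' i).2)) (fun i => (x i).2)
  simp only [simChoi, Matrix.add_apply, resourceChoi_apply, Finset.sum_add_distrib,
    ← Finset.mul_sum] at e ⊢
  rw [sum_swapTensor sum_maxEnt sum_maxEnt, sum_swapTensor sum_maxEnt hE,
    sum_swapTensor hE sum_maxEnt, sum_swapTensor hE hE, ← add_mul, ← add_mul, ← add_mul, e,
    if_congr hx rfl rfl, Matrix.one_apply, ite_and]
  split_ifs <;> simp

theorem SwapFeasible.isCPPTP (hd : 2 ≤ d) (h : SwapFeasible d K L M N) :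
    IsCPPTP (ofChoi (simChoi d K L M N)) := by
  have h0 := posSemidef_simChoi hd h.nonneg_K h.nonneg_L h.nonneg_M h.nonneg_N
  refine ⟨⟨isCP_ofChoi h0, trace_ofChoi (sum_simChoi hd h.sum_eq_one)⟩, fun S => ?_⟩
  rw [partialTranspose_comp_ofChoi]
  refine isCP_ofChoi ?_
  have hC : (partialTransposeChoi {Party.charlie} (simChoi d K L M N)).PosSemidef := by
    rw [partialTransposeChoi_simChoi]
    simp only [partialTransposeChoi_charlie]
    exact posSemidef_simChoi hd h.ppt_charlie_K h.ppt_charlie_L h.ppt_charlie_M h.ppt_charlie_N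
  have hA := h.posSemidef_partialTransposeChoi hd (p := .alice) (by simp)
  have hB := h.posSemidef_partialTransposeChoi hd (p := .bob) (by simp)
  have h0' := h0
  rw [← partialTransposeChoi_empty (simChoi d K L M N)] at h0'
  have hcompl : ∀ S : Finset Party, (partialTransposeChoi S (simChoi d K L M N)).PosSemidef →
      (partialTransposeChoi Sᶜ (simChoi d K L M N)).PosSemidef := by
    intro S hS
    rw [partialTransposeChoi_compl]
    exact hS.transpose
  -- The eight sets of parties are four sets and their complements, so only the empty set and the
  -- singletons need checking.
  have hS : S = ∅ ∨ S = {.alice} ∨ S = {.bob} ∨ S = {.charlie} ∨ S = ∅ᶜ ∨ S = {.alice}ᶜ ∨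
      S = {.bob}ᶜ ∨ S = {.charlie}ᶜ := by
    revert S; decide
  rcases hS with rfl | rfl | rfl | rfl | rfl | rfl | rfl | rfl
  exacts [h0', hA, hB, hC, hcompl _ h0', hcompl _ hA, hcompl _ hB, hcompl _ hC]

/-- Outcome K performs the swap exactly; the other three outcomes form T. -/
theorem SwapFeasible.simulation_eq (hd : 2 ≤ d) (h : SwapFeasible d K L M N)
    {ρ : Matrix (∀ p, R p) (∀ p, R p) ℂ} (hρ : IsState ρ) :
    0 ≤ (ρ * K).trace.re ∧ (ρ * K).trace.re ≤ 1 ∧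
    ∃ T, IsCP T ∧ ofChoi (simChoi d K L M N) ∘ₗ tensorResource ρ =
      ((ρ * K).trace.re : ℂ) • swapChannel d + T := by
  have hρ0 := nonneg_iff_posSemidef.2 hρ.1
  have hK := trace_mul_nonneg hρ0 h.nonneg_K
  have hL := trace_mul_nonneg hρ0 h.nonneg_L
  have hM := trace_mul_nonneg hρ0 h.nonneg_M
  have hN := trace_mul_nonneg hρ0 h.nonneg_N
  have hsum : (ρ * K).trace + (ρ * L).trace + (ρ * M).trace + (ρ * N).trace = 1 := by
    simp only [← trace_add, ← Matrix.mul_add, h.sum_eq_one, Matrix.mul_one, hρ.2]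
  have hre := congrArg Complex.re hsum
  simp only [Complex.add_re, Complex.one_re] at hre
  have hk : ((ρ * K).trace.re : ℂ) = (ρ * K).trace :=
    Complex.ext rfl (Complex.le_def.1 hK).2
  refine ⟨(Complex.le_def.1 hK).1, ?_, ofChoi ((ρ * L).trace • swapTensor (maxEnt d) (covChoi d)
    + (ρ * M).trace • swapTensor (covChoi d) (maxEnt d)
    + (ρ * N).trace • swapTensor (covChoi d) (covChoi d)), ?_, ?_⟩
  · have e1 := (Complex.le_def.1 hL).1
    have e2 := (Complex.le_def.1 hM).1
    have e3 := (Complex.le_def.1 hN).1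
    simp only [Complex.zero_re] at e1 e2 e3
    linarith
  · have h1 := posSemidef_maxEnt d (by omega)
    have h2 := posSemidef_covChoi hd
    exact isCP_ofChoi ((((posSemidef_swapTensor h1 h2).smul hL).add
      ((posSemidef_swapTensor h2 h1).smul hM)).add ((posSemidef_swapTensor h2 h2).smul hN))
  · rw [hk, ← ofChoi_choi (swapChannel d), choi_swapChannel]
    simp only [simChoi, map_add, map_smul, LinearMap.add_comp,
      ofChoi_resourceChoi_comp_tensorResource]
    abel

end Upper

/-! ### The maximally entangled test input. -/

section Overlap

variable {d : ℕ}

theorem choi_swapChannel_eq_vecMulVec : ∃ u : (∀ p, SwapSys d p) × (∀ p, SwapSys d p) → ℂ,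
    star u = u ∧ choi (swapChannel d) = vecMulVec u (star u) := by
  refine ⟨fun z => if z.1 = flipLabel d z.2 then 1 else 0, ?_, ?_⟩
  · ext z
    simp [apply_ite]
  · ext ⟨a, c⟩ ⟨a', c'⟩
    change swapChannel d (single a a' 1) c c' = _
    rw [swapChannel_apply, single, of_apply, vecMulVec_apply, Pi.star_apply, apply_ite star,
      star_one, star_zero]
    exact (ite_mul_ite Iff.rfl).symm

/-- Half of a maximally entangled state as an input of the swap channel. -/
theorem exists_entangled_input (hd : 0 < d) :
    ∃ (n : ℕ) (ω : Matrix (Fin n × (∀ p, SwapSys d p)) (Fin n × (∀ p, SwapSys d p)) ℂ)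
      (ψ : Fin n × (∀ p, SwapSys d p) → ℂ), IsState ω ∧ star ψ ⬝ᵥ ψ = 1 ∧
      ampliate (Fin n) (swapChannel d) ω = vecMulVec ψ (star ψ) ∧
      ∀ M : Matrix (∀ p, SwapSys d p) (∀ p, SwapSys d p) ℂ →ₗ[ℂ]
          Matrix (∀ p, SwapSys d p) (∀ p, SwapSys d p) ℂ,
        star ψ ⬝ᵥ ampliate (Fin n) M ω *ᵥ ψ =
          ((d : ℂ) ^ 4)⁻¹ * ∑ z, ∑ z', choi M z z' * swapTensor (maxEnt d) (maxEnt d) z z' := by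
  have hdc : (d : ℂ) ≠ 0 := by exact_mod_cast hd.ne'
  have hinv : 0 ≤ ((d : ℂ) ^ 2)⁻¹ := by
    rw [← Complex.ofReal_natCast, ← Complex.ofReal_pow, ← Complex.ofReal_inv]
    exact Complex.zero_le_real.2 (by positivity)
  obtain ⟨u, hu, hchoi⟩ := choi_swapChannel_eq_vecMulVec (d := d)
  let v := entangledVec (∀ p, SwapSys d p)
  let e := (Fintype.equivFin (∀ p, SwapSys d p)).symm.prodCongr (Equiv.refl (∀ p, SwapSys d p))
  -- Both v and u have squared norm d², the number of input labels. Normalizing ω and both copies of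
  -- ψ gives the factor d⁻⁴ in the overlap.
  let ω := ((d : ℂ) ^ 2)⁻¹ • vecMulVec v (star v)
  let ψ := (d : ℂ)⁻¹ • (u ∘ e)
  have hamp : ∀ M : Matrix (∀ p, SwapSys d p) (∀ p, SwapSys d p) ℂ →ₗ[ℂ]
      Matrix (∀ p, SwapSys d p) (∀ p, SwapSys d p) ℂ,
      ampliate _ M ω = ((d : ℂ) ^ 2)⁻¹ • (choi M).submatrix e e := by
    intro M
    rw [← ampliate_entangledVec]
    ext p q
    change M (((d : ℂ) ^ 2)⁻¹ • (Matrix.of fun c c' => vecMulVec v (star v) (p.1, c) (q.1, c')))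
      p.2 q.2 = _
    rw [map_smul]
    rfl
  have hω : IsState ω := by
    refine ⟨(posSemidef_vecMulVec_self_star v).smul hinv, ?_⟩
    have h : (vecMulVec v (star v)).trace = (d : ℂ) ^ 2 := by
      simp only [trace, diag_apply, vecMulVec_apply, Pi.star_apply, v, entangledVec, apply_ite star,
        star_one, star_zero, mul_ite, mul_one, mul_zero, Fintype.sum_prod_type_right]
      simp [-Fintype.card_pi, card_swapLabel]
    rw [trace_smul, h, smul_eq_mul, inv_mul_cancel₀ (pow_ne_zero 2 hdc)]
  have hstar : star ψ = (d : ℂ)⁻¹ • (star u ∘ e) := by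
    ext p
    simp [ψ]
  have hS : ampliate _ (swapChannel d) ω = vecMulVec ψ (star ψ) := by
    rw [hamp, hchoi, hstar]
    ext p q
    simp only [ψ, Matrix.smul_apply, submatrix_apply, vecMulVec_apply, Pi.smul_apply, smul_eq_mul,
      Function.comp_apply]
    ring
  refine ⟨_, ω, ψ, hω, ?_, hS, fun M => ?_⟩
  · rw [dotProduct_comm, ← trace_vecMulVec, ← hS]
    exact (isChannel_swapChannel.isState_ampliate hω).2
  · rw [← choi_swapChannel, hchoi, hamp, hstar, hu]
    simp only [dotProduct, mulVec, Matrix.smul_apply, submatrix_apply, ψ, Pi.smul_apply,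
      smul_eq_mul, Function.comp_apply, vecMulVec_apply, Finset.mul_sum]
    rw [← e.sum_comp]
    refine Finset.sum_congr rfl fun z _ => ?_
    rw [← e.sum_comp]
    exact Finset.sum_congr rfl fun z' _ => by ring

end Overlap

/-! ### Equality of both errors with the value of the program. -/

section Main

variable {d : ℕ} {R : Party → Type*} [∀ p, Fintype (R p)] [∀ p, DecidableEq (R p)]

/-- The right-hand side is the overlap in `exists_entangled_input`, so the objective at the
extracted K is what the test input measures. -/
theorem trace_mul_twirlPart (ρ : Matrix (∀ p, R p) (∀ p, R p) ℂ)
    (P : Matrix (∀ p, SwapSys d p × R p) (∀ p, SwapSys d p × R p) ℂ →ₗ[ℂ]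
      Matrix (∀ p, SwapSys d p) (∀ p, SwapSys d p) ℂ) :
    (ρ * twirlPart P true true).trace = ((d : ℂ) ^ 4)⁻¹ * ∑ z, ∑ z',
      choi (P ∘ₗ tensorResource ρ) z z' * swapTensor (maxEnt d) (maxEnt d) z z' := by
  have e : ((d : ℂ) ^ 2)⁻¹ • swapTensor ((d : ℂ)⁻¹ • maxEnt d) ((d : ℂ)⁻¹ • maxEnt d) =
      ((d : ℂ) ^ 4)⁻¹ • swapTensor (maxEnt d) (maxEnt d) := by
    ext z z'
    simp only [swapTensor_apply, Matrix.smul_apply, smul_eq_mul]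
    ring
  simp only [twirlPart, if_true]
  rw [e, map_smul, Matrix.mul_smul, trace_smul, trace_mul_resourcePairing, smul_eq_mul]

/-- The values of the objective of the semi-definite program. -/
def objectiveValues (d : ℕ) (ρ : Matrix (∀ p, R p) (∀ p, R p) ℂ) : Set ℝ :=
  {t : ℝ | ∃ K L M N : Matrix (∀ p, R p) (∀ p, R p) ℂ,
    SwapFeasible d K L M N ∧ t = (ρ * K).trace.re}

/-- This point makes both the supremum and the infimum range over nonempty sets. -/
theorem swapFeasible_zero (hd : 2 ≤ d) :
    SwapFeasible d (0 : Matrix (∀ p, R p) (∀ p, R p) ℂ) 0 0 1 := by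
  have h1 : ∀ S : Finset Party, 0 ≤ partialTranspose S (1 : Matrix (∀ p, R p) (∀ p, R p) ℂ) := by
    intro S
    have : partialTranspose S (1 : Matrix (∀ p, R p) (∀ p, R p) ℂ) = 1 := by
      ext x y
      rw [partialTranspose_apply, Matrix.one_apply, Matrix.one_apply]
      refine if_congr ⟨fun h => ?_, fun h => by rw [h]⟩ rfl rfl
      calc x = S.piecewise (S.piecewise x y) (S.piecewise y x) :=
            (piecewise_piecewise_swap S x y).symm
        _ = S.piecewise (S.piecewise y x) (S.piecewise x y) := by rw [h]
        _ = y := piecewise_piecewise_swap S y x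
    rw [this]
    exact zero_le_one
  have hd2 : (2 : ℝ) ≤ d := by exact_mod_cast hd
  have hs : ∀ (S : Finset Party) {c : ℝ}, 0 ≤ c →
      0 ≤ c • partialTranspose S (1 : Matrix (∀ p, R p) (∀ p, R p) ℂ) := fun S c hc =>
    smul_nonneg hc (h1 S)
  have hm : 0 ≤ (d : ℝ) - 1 := by linarith
  have hreal : ∀ (S : Finset Party) (c : ℝ),
      partialTranspose S (c • (1 : Matrix (∀ p, R p) (∀ p, R p) ℂ)) =
        c • partialTranspose S 1 := fun S c => rfl
  refine ⟨le_rfl, le_rfl, le_rfl, zero_le_one, by simp, ?_, ?_, ?_, ?_, by simp, by simp, by simp,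
    h1 _⟩ <;> intro p _ <;>
    simp only [smul_zero, add_zero, zero_add, map_zero, hreal, smul_smul] <;>
    exact hs _ (by positivity)

theorem objectiveValues_nonempty (hd : 2 ≤ d) (ρ : Matrix (∀ p, R p) (∀ p, R p) ℂ) :
    (objectiveValues d ρ).Nonempty := ⟨_, 0, 0, 0, 1, swapFeasible_zero hd, rfl⟩

theorem objectiveValues_bddAbove (hd : 2 ≤ d) {ρ : Matrix (∀ p, R p) (∀ p, R p) ℂ}
    (hρ : IsState ρ) : BddAbove (objectiveValues d ρ) := by
  refine ⟨1, ?_⟩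
  rintro t ⟨K, L, M, N, h, rfl⟩
  exact (h.simulation_eq hd hρ).2.1

/-- An error measure whose minimum over simulations is governed by the semi-definite program. -/
theorem sInf_eq_one_sub_sSup (hd : 2 ≤ d) {ρ : Matrix (∀ p, R p) (∀ p, R p) ℂ} (hρ : IsState ρ)
    (err : (Matrix (∀ p, SwapSys d p × R p) (∀ p, SwapSys d p × R p) ℂ →ₗ[ℂ]
      Matrix (∀ p, SwapSys d p) (∀ p, SwapSys d p) ℂ) → ℝ)
    (hlow : ∀ P, IsCPPTP P → 1 - (ρ * twirlPart P true true).trace.re ≤ err P)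
    (hup : ∀ K L M N, SwapFeasible d K L M N →
      err (ofChoi (simChoi d K L M N)) ≤ 1 - (ρ * K).trace.re) :
    sInf {e : ℝ | ∃ P, IsCPPTP P ∧ e = err P} = 1 - sSup (objectiveValues d ρ) := by
  have hbdd : ∀ e ∈ {e : ℝ | ∃ P, IsCPPTP P ∧ e = err P}, 1 - sSup (objectiveValues d ρ) ≤ e := by
    rintro e ⟨P, hP, rfl⟩
    have := le_csSup (objectiveValues_bddAbove hd hρ)
      ⟨_, _, _, _, twirlPart_feasible hd hP, rfl⟩
    linarith [hlow P hP]
  refine le_antisymm ?_ (le_csInf ⟨_, _, (swapFeasible_zero hd).isCPPTP hd, rfl⟩ hbdd)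
  have h : sSup (objectiveValues d ρ) ≤ 1 - sInf {e : ℝ | ∃ P, IsCPPTP P ∧ e = err P} := by
    refine csSup_le (objectiveValues_nonempty hd ρ) ?_
    rintro t ⟨K, L, M, N, h, rfl⟩
    have := csInf_le ⟨_, hbdd⟩ ⟨_, h.isCPPTP hd, rfl⟩
    linarith [hup K L M N h]
  linarith

theorem pptError_swapChannel (hd : 2 ≤ d) {ρ : Matrix (∀ p, R p) (∀ p, R p) ℂ} (hρ : IsState ρ) :
    pptError (swapChannel d) ρ = 1 - sSup (objectiveValues d ρ) := by
  refine sInf_eq_one_sub_sSup hd hρ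
    (fun P => 1 / 2 * diamondDist (swapChannel d) (P ∘ₗ tensorResource ρ)) ?_ ?_
  · intro P hP
    obtain ⟨n, ω, ψ, hω, hψ, hS, hM⟩ := exists_entangled_input (d := d) (by omega)
    rw [trace_mul_twirlPart, ← hM]
    exact one_sub_le_half_diamondDist isChannel_swapChannel
      (hP.1.comp (isChannel_tensorResource hρ)) hω hψ hS
  · intro K L M N h
    obtain ⟨-, h1, T, hT, e⟩ := h.simulation_eq hd hρ
    have := diamondDist_le_of_eq_add isChannel_swapChannel
      ((h.isCPPTP hd).1.comp (isChannel_tensorResource hρ)) hT h1 e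
    linarith

theorem pptErrorF_swapChannel (hd : 2 ≤ d) {ρ : Matrix (∀ p, R p) (∀ p, R p) ℂ} (hρ : IsState ρ) :
    pptErrorF (swapChannel d) ρ = 1 - sSup (objectiveValues d ρ) := by
  obtain ⟨n, ω, ψ, hω, hψ, hS, hM⟩ := exists_entangled_input (d := d) (by omega)
  refine sInf_eq_one_sub_sSup hd hρ
    (fun P => 1 - channelFidelity (swapChannel d) (P ∘ₗ tensorResource ρ)) ?_ ?_
  · intro P hP
    rw [trace_mul_twirlPart, ← hM]
    exact sub_le_sub_left
      (channelFidelity_le (hP.1.comp (isChannel_tensorResource hρ)) hω hψ hS) 1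
  · intro K L M N h
    obtain ⟨h0, -, T, hT, e⟩ := h.simulation_eq hd hρ
    exact sub_le_sub_left
      (le_channelFidelity_of_eq_add isChannel_swapChannel hT h0 e ⟨n, ω, hω⟩) 1

end Main

end QChannel

open QChannel
theorem mainTheorem9 (d : ℕ) (hd : 2 ≤ d) {R : Party → Type*} [∀ p, Fintype (R p)]
    [∀ p, DecidableEq (R p)] (ρ : Matrix (∀ p, R p) (∀ p, R p) ℂ) (hρ : IsState ρ) :
    pptError (swapChannel d) ρ = pptErrorF (swapChannel d) ρ ∧
    pptErrorF (swapChannel d) ρ =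
      1 - sSup {t : ℝ | ∃ K L M N : Matrix (∀ p, R p) (∀ p, R p) ℂ,
        SwapFeasible d K L M N ∧ t = (ρ * K).trace.re} :=
  ⟨(pptError_swapChannel hd hρ).trans (pptErrorF_swapChannel hd hρ).symm,
    pptErrorF_swapChannel hd hρ⟩
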